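/- **Theorem 3.8.** Digraphs have no parallel arcs but may have loops; a walk may repeat vertices and arcs. Call a digraph $\mathscr F_k$-free if it does not contain two different walks of length $k$ with the same initial vertex and the same terminal vertex. Let $ex(n,\mathscr F_k)$ be the maximum number of arcs of an $\mathscr F_k$-free digraph on the vertex set $\{1,\dots,n\}$, and let $Ex(n,\mathscr F_k)$ be the set of $\mathscr F_k$-free digraphs on $\{1,\dots,n\}$ with exactly $ex(n,\mathscr F_k)$ arcs. Matrices $A,B$ are permutation similar if $B=PAP^T$ for some permutation matrix $P$. Let $J_{p,q}$ be the $p\times q$ all-ones matrix and $T_p$ the $p\times p$ matrix whose $(i,j)$ entry is $1$ if $i<j$ and $0$ otherwise. Let $n\ge 9$ be an integer. A digraph $D$ on $\{1,\dots,n\}$ is in $Ex(n,\mathscr F_{n-4})$ if and only if its adjacency matrix $A_D$ is permutation similar to one of the following $n\times n$ matrices: $$F_1(n)=\begin{bmatrix}0&J_{3,n-5}&J_{3,2}\\0&T_{n-5}&J_{n-5,2}\\0&0&0\end{bmatrix},\qquad F_2(n)=\begin{bmatrix}0&J_{2,n-5}&J_{2,3}\\0&T_{n-5}&J_{n-5,3}\\0&0&0\end{bmatrix},$$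 $$F_3(n)=\begin{bmatrix}0&J_{2,n-5}&J_{2,2}&J_{2,1}\\0&T_{n-5}&J_{n-5,2}&U_m\\0&0&0&0\\0&U'_m&J_{1,2}&0\end{bmatrix},\qquad F_4(n)=\begin{bmatrix}T_{n-4}&w_1&w_2&w_3&w_4\\u_1&0&1&1&1\\u_2&0&0&1&1\\u_3&0&0&0&1\\u_4&0&0&0&0\end{bmatrix},$$ where in $F_3(n)$ the column $U_m=(J_{1,m},0)^T$ has length $n-5$ and the row $U'_m=(0,J_{1,n-m-7})$ has length $n-5$, for some integer $m$ with $0\le m\le n-7$, and in $F_4(n)$ the columns $w_j=(J_{1,k_j},0)^T$ and the rows $u_j=(0,J_{1,n-k_j-5})$ have length $n-4$, for $j=1,2,3,4$ and some integers $0\le k_1<k_2<k_3<k_4\le n-5$. -/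

import Mathlib

namespace WalkTuran

/-- `p 0 → p 1 → ⋯ → p k` is a walk of length `k` in `D` (vertices and arcs may be repeated).
`Digraph` has no parallel arcs and allows loops. -/
def IsWalk {V : Type*} (D : Digraph V) (k : ℕ) (p : Fin (k + 1) → V) : Prop :=
  ∀ i : Fin k, D.Adj (p i.castSucc) (p i.succ)

/-- `D` contains no member of the family `𝓕_k`, that is, `D` does not contain two different walks
of length `k` with the same initial vertex and the same terminal vertex. -/
def WalkFree {V : Type*} (k : ℕ) (D : Digraph V) : Prop :=
  ¬ ∃ p q : Fin (k + 1) → V, IsWalk D k p ∧ IsWalk D k q ∧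
      p 0 = q 0 ∧ p (Fin.last k) = q (Fin.last k) ∧ p ≠ q

/-- The size of a digraph: its number of arcs (loops included). -/
noncomputable def size {V : Type*} (D : Digraph V) : ℕ :=
  Set.ncard {a : V × V | D.Adj a.1 a.2}

/-- The Turán number `ex(n, 𝓕_k)`: the maximum size of an `𝓕_k`-free digraph on `n` vertices.
The supremum is over a bounded set, and for `k ≥ 1` the arcless digraph shows it is nonempty. -/
noncomputable def ex (n k : ℕ) : ℕ :=
  sSup {m : ℕ | ∃ D : Digraph (Fin n), WalkFree k D ∧ size D = m}

/-- The extremal digraphs `Ex(n, 𝓕_k)`: the `𝓕_k`-free digraphs on `n` vertices with size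
`ex(n, 𝓕_k)`. -/
def Ex (n k : ℕ) : Set (Digraph (Fin n)) :=
  {D | WalkFree k D ∧ size D = ex n k}

open Classical in
/-- The adjacency matrix of a digraph. -/
noncomputable def adjMatrix {n : ℕ} (D : Digraph (Fin n)) : Matrix (Fin n) (Fin n) ℕ :=
  Matrix.of fun i j => if D.Adj i j then 1 else 0

/-- `B = P A Pᵀ` for some permutation matrix `P`. -/
def PermSimilar {n : ℕ} (A B : Matrix (Fin n) (Fin n) ℕ) : Prop :=
  ∃ σ : Equiv.Perm (Fin n), B = σ.permMatrix ℕ * A * (σ.permMatrix ℕ).transpose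

/-- With block sizes `3, n - 5, 2` (rows and columns are numbered from `0`):
```
0  J  J
0  T  J
0  0  0
```
-/
def F₁ (n : ℕ) : Matrix (Fin n) (Fin n) ℕ := Matrix.of fun i j =>
  if i.val < 3 then (if 3 ≤ j.val then 1 else 0)
  else if i.val < n - 2 then (if i < j then 1 else 0)
  else 0

/-- With block sizes `2, n - 5, 3`:
```
0  J  J
0  T  J
0  0  0
```
-/
def F₂ (n : ℕ) : Matrix (Fin n) (Fin n) ℕ := Matrix.of fun i j =>
  if i.val < 2 then (if 2 ≤ j.val then 1 else 0)
  else if i.val < n - 3 then (if i < j then 1 else 0)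
  else 0

/-- With block sizes `2, n - 5, 2, 1`:
```
0  J   J  J
0  T   J  U
0  0   0  0
0  U'  J  0
```
where the column `U` has its first `m` entries equal to `1` and the others `0`, and the row `U'` has
its last `n - m - 7` entries equal to `1` and the others (the first `m + 2`) `0`. -/
def F₃ (n m : ℕ) : Matrix (Fin n) (Fin n) ℕ := Matrix.of fun i j =>
  if i.val < 2 then (if 2 ≤ j.val then 1 else 0)
  else if i.val < n - 3 then
    (if j.val < n - 1 then (if i < j then 1 else 0) else (if i.val < 2 + m then 1 else 0))
  else if i.val < n - 1 then 0
  else (if 2 + (m + 2) ≤ j.val ∧ j.val < n - 1 then 1 else 0)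

/-- With block sizes `n - 4, 1, 1, 1, 1`:
```
T    w₀  w₁  w₂  w₃
u₀   0   1   1   1
u₁   0   0   1   1
u₂   0   0   0   1
u₃   0   0   0   0
```
where the column `w_r` has its first `k r` entries equal to `1` and the others `0`, and the row `u_r`
has its last `n - k r - 5` entries equal to `1` and the others (the first `k r + 1`) `0`. -/
def F₄ (n : ℕ) (k : Fin 4 → ℕ) : Matrix (Fin n) (Fin n) ℕ := Matrix.of fun i j =>
  if hi : i.val < n - 4 then
    (if hj : j.val < n - 4 then (if i < j then 1 else 0)
     else (if i.val < k ⟨j.val - (n - 4), by omega⟩ then 1 else 0))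
  else
    (if j.val < n - 4 then (if k ⟨i.val - (n - 4), by omega⟩ + 1 ≤ j.val then 1 else 0)
     else (if i < j then 1 else 0))

end WalkTuran

/-! Put `k = n - 4 ≥ 5`. The extremal size is `n(n-1)/2 - 4`, so the proof counts pairs of vertices
that are not joined by an arc.

A digraph with a closed walk is too small: `arcsIn_bound_of_closedWalk` gives at most `n(n-1)/2 - n
+ 4` arcs. A shortest closed walk is an induced cycle. Walks can run round it as long as needed, so
a short detour through an outside vertex produces two walks of length `k` with the same ends. Hence
an outside vertex has at most `g` arcs to and from a cycle of length `g`, and two disjoint cycles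
have few arcs between them. Removing the cycle gives an induction.

Otherwise the digraph is acyclic. Grade each vertex by the length of a longest walk ending there,
sort the vertices by this height, and let `R` be the number of positions whose successor is on the
same level. The top height is `n - 1 - R`, and every such position is a missing pair. If `R ≤ 2`,
some walk is longer than `k`, and two nearby skips `w t → w (t + 2)` along it would give two walks
of length `k`; so at least five pairs are missing (`IsHeight.five_le_missing`). If `R = 4` and only
four pairs are missing, all other pairs are joined, and `F₄` results. If `R = 3`, the top height is
exactly `k` and one further pair may be missing. A level strictly between bottom and top with two
vertices yields two walks unless that pair blocks one of them (`IsHeight.eq_of_internal`). So a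
fourth missing pair must exist, and it leads to `F₁`, `F₂` or `F₃`.

Conversely, the four matrices miss at most four pairs. In a digraph graded by `0, …, k`, a walk of
length `k` meets each level once, so freeness only has to be checked level by level
(`walkFree_of_level`). -/

namespace WalkTuran

/-! ### Walks that run round a cycle. -/

section Walk

variable {V : Type*} {D : Digraph V} {k : ℕ}

/-- Indexing walks by `ℕ` lets later proofs splice them with `if` on the time; values beyond `k` are
irrelevant. -/
theorem WalkFree.eq_of_walks (hD : WalkFree k D) {p q : ℕ → V}
    (hp : ∀ i < k, D.Adj (p i) (p (i + 1))) (hq : ∀ i < k, D.Adj (q i) (q (i + 1)))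
    (h0 : p 0 = q 0) (hk : p k = q k) : ∀ i ≤ k, p i = q i := by
  by_contra! hne
  obtain ⟨i, hi, hne⟩ := hne
  refine hD ⟨fun i => p i, fun i => q i, fun i => ?_, fun i => ?_, ?_, ?_, fun e => hne ?_⟩
  · simpa using hp i i.2
  · simpa using hq i i.2
  · simpa using h0
  · simpa using hk
  · exact congrFun e ⟨i, by omega⟩

section Cycle

variable {g : ℕ} {c : ZMod g → V}

theorem adj_cycle_cast (hc : ∀ i, D.Adj (c i) (c (i + 1))) (a : ZMod g) (t : ℕ) :
    D.Adj (c (a + t)) (c (a + (t + 1 : ℕ))) := by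
  have := hc (a + t)
  rwa [add_assoc, ← Nat.cast_succ] at this

/-- The detour through `v` could replace `c (i + 1)`; both walks then continue round the cycle up to
length `k`. -/
theorem cycle_not_adj_two (hD : WalkFree k D) (hk : 2 ≤ k) (hc : ∀ i, D.Adj (c i) (c (i + 1)))
    {v : V} (hv : ∀ i, c i ≠ v) {i : ZMod g} (h1 : D.Adj (c i) v) : ¬ D.Adj v (c (i + 2)) := by
  intro h2
  have := hD.eq_of_walks (p := fun t => c (i + t)) (q := fun t => if t = 1 then v else c (i + t))
    (fun t _ => adj_cycle_cast hc i t) ?_ (by simp) ?_ 1 (by omega)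
  · simp at this
    exact hv _ this
  · intro t _
    rcases t with _ | _ | t
    · simpa using h1
    · simpa [one_add_one_eq_two] using h2
    · rw [if_neg (by omega), if_neg (by omega)]
      exact adj_cycle_cast hc i (t + 2)
  · rw [if_neg (by omega)]

/-- Spend `k - 2` steps on the cycle to reach `c i`; from there both `c (i + 1)` and `v` would lead
to `w` in two steps. -/
theorem cycle_not_adj_out (hD : WalkFree k D) (hk : 2 ≤ k) (hc : ∀ i, D.Adj (c i) (c (i + 1)))
    {v w : V} (hv : ∀ i, c i ≠ v) (hvw : D.Adj v w) {i : ZMod g} (h1 : D.Adj (c i) v) :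
    ¬ D.Adj (c (i + 1)) w := by
  intro h2
  obtain ⟨k, rfl⟩ : ∃ l, k = l + 2 := ⟨k - 2, by omega⟩
  have := hD.eq_of_walks (p := fun t => if t = k + 2 then w else c (i - k + t))
    (q := fun t => if t = k + 2 then w else if t = k + 1 then v else c (i - k + t))
    ?_ ?_ (by simp) (by simp) (k + 1) (by omega)
  · simp at this
    exact hv _ this
  · intro t ht
    rw [if_neg (by omega)]
    split_ifs with h
    · obtain rfl : t = k + 1 := by omega
      convert h2 using 2
      push_cast; ring
    · exact adj_cycle_cast hc _ t
  · intro t ht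
    rw [if_neg (by omega : t ≠ k + 2)]
    by_cases h : t = k + 1
    · simpa [h] using hvw
    · rw [if_neg h, if_neg (by omega)]
      split_ifs with h'
      · obtain rfl : t = k := by omega
        simpa using h1
      · exact adj_cycle_cast hc _ t

/-- Mirror image of `cycle_not_adj_out`: the walks branch at `v`, rejoin at `c (i + 1)`, and use up
the remaining steps on the cycle. -/
theorem cycle_not_adj_in (hD : WalkFree k D) (hk : 2 ≤ k) (hc : ∀ i, D.Adj (c i) (c (i + 1)))
    {v w : V} (hw : ∀ i, c i ≠ w) (hvw : D.Adj v w) {i : ZMod g} (h1 : D.Adj v (c i)) :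
    ¬ D.Adj w (c (i + 1)) := by
  intro h2
  have := hD.eq_of_walks (p := fun t => if t = 0 then v else c (i - 1 + t))
    (q := fun t => if t = 0 then v else if t = 1 then w else c (i - 1 + t))
    ?_ ?_ (by simp) ?_ 1 (by omega)
  · simp at this
    exact hw _ this
  · intro t ht
    rcases t with _ | t
    · simpa using h1
    · simpa using adj_cycle_cast hc (i - 1) (t + 1)
  · intro t ht
    rcases t with _ | _ | t
    · simpa using hvw
    · simp
      convert h2 using 2
      ring
    · iterate 4 rw [if_neg (by omega)]
      exact adj_cycle_cast hc (i - 1) (t + 2)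
  · rw [if_neg (by omega), if_neg (by omega), if_neg (by omega)]

theorem cycle_not_adj_three (hD : WalkFree k D) (hk : 3 ≤ k) (hc : ∀ i, D.Adj (c i) (c (i + 1)))
    {v w : V} (hv : ∀ i, c i ≠ v) (hvw : D.Adj v w) {i : ZMod g} (h1 : D.Adj (c i) v) :
    ¬ D.Adj w (c (i + 3)) := by
  intro h2
  have := hD.eq_of_walks (p := fun t => c (i + t))
    (q := fun t => if t = 1 then v else if t = 2 then w else c (i + t))
    (fun t _ => adj_cycle_cast hc i t) ?_ (by simp) ?_ 1 (by omega)
  · simp at this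
    exact hv _ this
  · intro t _
    rcases t with _ | _ | _ | t
    · simpa using h1
    · simpa using hvw
    · simp
      convert h2 using 2
    · iterate 4 rw [if_neg (by omega)]
      exact adj_cycle_cast hc i (t + 3)
  · rw [if_neg (by omega), if_neg (by omega)]

/-- Each such index gives a walk of length `k` from `v` to `w`, with `k - 2` steps on the cycle. -/
theorem cycle_through_unique (hD : WalkFree k D) (hk : 2 ≤ k)
    (hc : ∀ i, D.Adj (c i) (c (i + 1))) {v w : V} {i j : ZMod g}
    (hi : D.Adj v (c i)) (hj : D.Adj v (c j)) (hi' : D.Adj (c (i + (k - 2 : ℕ))) w)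
    (hj' : D.Adj (c (j + (k - 2 : ℕ))) w) : c i = c j := by
  obtain ⟨k, rfl⟩ : ∃ l, k = l + 2 := ⟨k - 2, by omega⟩
  have key : ∀ i : ZMod g, D.Adj v (c i) → D.Adj (c (i + (k + 2 - 2 : ℕ))) w → ∀ t < k + 2,
      D.Adj (if t = 0 then v else if t = k + 2 then w else c (i + (t - 1 : ℕ)))
      (if t + 1 = 0 then v else if t + 1 = k + 2 then w else c (i + (t + 1 - 1 : ℕ))) := by
    intro i hi hi' t ht
    rcases t with _ | t
    · simpa using hi
    · rw [if_neg (by omega), if_neg (by omega), if_neg (by omega)]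
      split_ifs with h
      · obtain rfl : t = k := by omega
        simpa using hi'
      · exact adj_cycle_cast hc i t
  have := hD.eq_of_walks (key i hi hi') (key j hj hj') (by simp) (by simp) 1 (by omega)
  simpa using this

/-- A walk from `c a` may cross to the second cycle at time `0` or at time `s`; the crossing costs
one step either way, so both walks end at the same vertex. -/
theorem cycle_cycle_not_adj (hD : WalkFree k D) {g' : ℕ} {c' : ZMod g' → V}
    (hc : ∀ i, D.Adj (c i) (c (i + 1))) (hc' : ∀ i, D.Adj (c' i) (c' (i + 1)))
    (hne : ∀ i j, c i ≠ c' j) {a : ZMod g} {b : ZMod g'} {s : ℕ} (hs : 0 < s) (hsk : s < k)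
    (h : D.Adj (c a) (c' b)) : ¬ D.Adj (c (a + s)) (c' (b + s)) := by
  intro h'
  have key : ∀ s < k, D.Adj (c (a + s)) (c' (b + s)) → ∀ t < k,
      D.Adj (if t ≤ s then c (a + t) else c' (b + (t - 1 : ℕ)))
        (if t + 1 ≤ s then c (a + (t + 1 : ℕ)) else c' (b + (t + 1 - 1 : ℕ))) := by
    intro s hs h t ht
    split_ifs with h1 h2 h2
    · exact adj_cycle_cast hc a t
    · obtain rfl : t = s := by omega
      exact h
    · omega
    · obtain ⟨t, rfl⟩ : ∃ l, t = l + 1 := ⟨t - 1, by omega⟩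
      exact adj_cycle_cast hc' b t
  have := hD.eq_of_walks (key 0 (by omega) (by simpa using h)) (key s hsk h') (by simp)
    (by rw [if_neg (by omega), if_neg (by omega)]) 1 (by omega)
  rw [if_neg (by omega), if_pos (by omega)] at this
  exact hne _ _ this.symm

end Cycle

/-- `D` has a closed walk of length `g` inside `S`. -/
def HasClosedWalk (D : Digraph V) (S : Finset V) (g : ℕ) : Prop :=
  ∃ c : ZMod g → V, (∀ i, c i ∈ S) ∧ ∀ i, D.Adj (c i) (c (i + 1))

theorem zmod_val_add_one {g : ℕ} [NeZero g] (x : ZMod g) :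
    (x + 1).val = if x.val + 1 = g then 0 else x.val + 1 := by
  have hx := ZMod.val_lt x
  have h : x + 1 = ((x.val + 1 : ℕ) : ZMod g) := by simp
  rw [h, ZMod.val_natCast]
  split_ifs with h5
  · rw [h5, Nat.mod_self]
  · exact Nat.mod_eq_of_lt (by omega)

/-- A shortest closed walk is an induced cycle. -/
theorem exists_induced_cycle {S : Finset V} (h : ∃ g, 0 < g ∧ HasClosedWalk D S g) :
    ∃ (g : ℕ) (_ : NeZero g) (c : ZMod g → V), (∀ i, c i ∈ S) ∧ Function.Injective c ∧
      (∀ i j, D.Adj (c i) (c j) ↔ j = i + 1) ∧ ∀ g', 0 < g' → HasClosedWalk D S g' → g ≤ g' := by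
  classical
  obtain ⟨hg, c, hcS, hc⟩ := Nat.find_spec h
  have hmin : ∀ g', 0 < g' → HasClosedWalk D S g' → Nat.find h ≤ g' := fun g' h1 h2 =>
    Nat.find_min' h ⟨h1, h2⟩
  generalize Nat.find h = g at *
  have : NeZero g := ⟨by omega⟩
  have chord : ∀ i j, D.Adj (c i) (c j) → j = i + 1 := by
    intro i j hij
    -- Following the cycle from `c j` to `c i` and closing up with the chord takes `(i - j).val + 1`
    -- steps; minimality forces this to be `g`.
    have hlt := ZMod.val_lt (i - j)
    have := hmin ((i - j).val + 1) (by omega) ⟨fun x => c (j + (x.val : ℕ)), fun _ => hcS _, ?_⟩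
    · have h2 : (((i - j).val + 1 : ℕ) : ZMod g) = 0 := by
        rw [show (i - j).val + 1 = g by omega]; simp
      have h3 : i - j + 1 = 0 := by simpa using h2
      linear_combination -h3
    · intro x
      simp only [zmod_val_add_one, add_left_inj]
      split_ifs with h5
      · rw [h5]
        simpa using hij
      · exact adj_cycle_cast hc j x.val
  refine ⟨g, this, c, hcS, ?_, fun i j => ⟨chord i j, fun h => h ▸ hc i⟩, hmin⟩
  -- If `c i = c j`, the arc from `c (j - 1)` to `c j` is also an arc to `c i`, so the chord
  -- property gives `i = j`.
  intro i j hij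
  have h1 := hc (j - 1)
  rw [sub_add_cancel, ← hij] at h1
  have := chord _ _ h1
  simpa using this

open Classical in
/-- The number of arcs from `u` to `v`, which is `0` or `1`. -/
noncomputable def arc (D : Digraph V) (u v : V) : ℕ := if D.Adj u v then 1 else 0

theorem arc_le_one (u v : V) : arc D u v ≤ 1 := by
  unfold arc; split_ifs <;> omega

theorem arc_eq_one {u v : V} : arc D u v = 1 ↔ D.Adj u v := by
  unfold arc; split_ifs <;> simp_all

theorem arc_eq_zero {u v : V} : arc D u v = 0 ↔ ¬ D.Adj u v := by
  unfold arc; split_ifs <;> simp_all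

/-- The number of arcs inside `S`. -/
noncomputable def arcsIn (D : Digraph V) (S : Finset V) : ℕ := ∑ u ∈ S, ∑ v ∈ S, arc D u v

/-- The number of arcs between the cycle `c` and the vertex `v`. -/
noncomputable def cycleDeg {g : ℕ} [NeZero g] (D : Digraph V) (c : ZMod g → V) (v : V) : ℕ :=
  ∑ i, (arc D (c i) v + arc D v (c i))

theorem arcsIn_eq_add_cycle [DecidableEq V] {g : ℕ} [NeZero g] {c : ZMod g → V} {S : Finset V}
    (hS : ∀ i, c i ∈ S) (hinj : Function.Injective c)
    (hc : ∀ i j, D.Adj (c i) (c j) ↔ j = i + 1) :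
    arcsIn D S = g + ∑ v ∈ S \ Finset.univ.image c, cycleDeg D c v
      + arcsIn D (S \ Finset.univ.image c) := by
  have hsub : Finset.univ.image c ⊆ S := by
    intro x hx
    obtain ⟨i, -, rfl⟩ := Finset.mem_image.1 hx
    exact hS i
  have split : ∀ f : V → ℕ, ∑ v ∈ S, f v = ∑ v ∈ S \ Finset.univ.image c, f v + ∑ i, f (c i) := by
    intro f
    rw [← Finset.sum_sdiff hsub, Finset.sum_image hinj.injOn]
  have hg : ∑ i, ∑ j, arc D (c i) (c j) = g := by
    have : ∀ i, ∑ j, arc D (c i) (c j) = 1 := fun i => by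
      simp [arc, hc]
    simp [this, ZMod.card]
  unfold arcsIn cycleDeg
  rw [split]
  simp only [split, Finset.sum_add_distrib, hg]
  rw [Finset.sum_comm (s := Finset.univ)]
  ring

/-! ### Arcs between a cycle and an outside vertex. -/

section Degree

variable {g : ℕ} {c : ZMod g → V}

theorem arc_add_arc_shift_le (hD : WalkFree k D) (hk : 2 ≤ k)
    (hc : ∀ i, D.Adj (c i) (c (i + 1))) {v : V} (hv : ∀ i, c i ≠ v) (i : ZMod g) :
    arc D (c i) v + arc D v (c (i + 2)) ≤ 1 := by
  by_cases h : D.Adj (c i) v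
  · have := arc_eq_zero.2 (cycle_not_adj_two hD hk hc hv h)
    have := arc_le_one (D := D) (c i) v
    omega
  · have := arc_eq_zero.2 h
    have := arc_le_one (D := D) v (c (i + 2))
    omega

variable [NeZero g]

/-- The shift by `2` pairs the two arcs that would form a detour through `v`, so that every summand
is at most `1`. -/
theorem cycleDeg_eq_shift (D : Digraph V) (c : ZMod g → V) (v : V) :
    cycleDeg D c v = ∑ i, (arc D (c i) v + arc D v (c (i + 2))) := by
  unfold cycleDeg
  rw [Finset.sum_add_distrib, Finset.sum_add_distrib,
    ← Equiv.sum_comp (Equiv.addRight (2 : ZMod g)) (fun i => arc D v (c i))]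
  rfl

theorem cycleDeg_le (hD : WalkFree k D) (hk : 2 ≤ k) (hc : ∀ i, D.Adj (c i) (c (i + 1)))
    {v : V} (hv : ∀ i, c i ≠ v) : cycleDeg D c v ≤ g := by
  rw [cycleDeg_eq_shift]
  calc _ ≤ ∑ i : ZMod g, 1 := Finset.sum_le_sum fun i _ => arc_add_arc_shift_le hD hk hc hv i
    _ = g := by simp [ZMod.card]

theorem adj_or_adj_of_cycleDeg_eq (hD : WalkFree k D) (hk : 2 ≤ k)
    (hc : ∀ i, D.Adj (c i) (c (i + 1))) {v : V} (hv : ∀ i, c i ≠ v) (h : cycleDeg D c v = g)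
    (i : ZMod g) : D.Adj (c i) v ∨ D.Adj v (c (i + 2)) := by
  rw [cycleDeg_eq_shift] at h
  have h1 : ∑ i, (arc D (c i) v + arc D v (c (i + 2))) = ∑ i : ZMod g, 1 := by
    rw [h]; simp [ZMod.card]
  have := (Finset.sum_eq_sum_iff_of_le
    fun i _ => arc_add_arc_shift_le hD hk hc hv i).1 h1 i (Finset.mem_univ _)
  by_contra! h2
  rw [arc_eq_zero.2 h2.1, arc_eq_zero.2 h2.2] at this
  omega

/-- An arc `v → w` would rule out every arc from the cycle to `v`. Equality in the degree bound then
makes `v` dominate the whole cycle, and the cycle dominate `w`, so entering at `c 0` or at `c 1`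
gives two walks from `v` to `w`. -/
theorem not_adj_of_cycleDeg_eq (hD : WalkFree k D) (hk : 3 ≤ k) (hg : 2 ≤ g)
    (hinj : Function.Injective c) (hc : ∀ i, D.Adj (c i) (c (i + 1))) {v w : V}
    (hv : ∀ i, c i ≠ v) (hw : ∀ i, c i ≠ w) (hfv : cycleDeg D c v = g) (hfw : cycleDeg D c w = g) :
    ¬ D.Adj v w := by
  intro hvw
  have hk2 : 2 ≤ k := by omega
  have h1 : ∀ i, ¬ D.Adj (c i) v := by
    intro i hi
    rcases adj_or_adj_of_cycleDeg_eq hD hk2 hc hw hfw (i + 1) with h | h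
    · exact cycle_not_adj_out hD hk2 hc hv hvw hi h
    · refine cycle_not_adj_three hD hk hc hv hvw hi ?_
      convert h using 2
      ring
  have h2 : ∀ i, D.Adj v (c i) := by
    intro i
    have := (adj_or_adj_of_cycleDeg_eq hD hk2 hc hv hfv (i - 2)).resolve_left (h1 _)
    simpa using this
  have h3 : ∀ i, D.Adj (c i) w := by
    intro i
    refine (adj_or_adj_of_cycleDeg_eq hD hk2 hc hw hfw i).resolve_right fun h => ?_
    refine cycle_not_adj_in hD hk2 hc hw hvw (h2 (i + 1)) ?_
    convert h using 2
    ring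
  have := hinj (cycle_through_unique hD hk2 hc (h2 0) (h2 1) (h3 _) (h3 _))
  have : Fact (1 < g) := ⟨by omega⟩
  exact zero_ne_one ‹(0 : ZMod g) = 1›

end Degree

/-- The arcs from a cycle of length `g` to a disjoint cycle of length `g'`. -/
theorem mul_arcs_cycle_cycle_le (hD : WalkFree k D) {g g' : ℕ} [NeZero g] [NeZero g']
    {c : ZMod g → V} {c' : ZMod g' → V} (hc : ∀ i, D.Adj (c i) (c (i + 1)))
    (hc' : ∀ i, D.Adj (c' i) (c' (i + 1))) (hne : ∀ i j, c i ≠ c' j) :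
    k * ∑ i, ∑ j, arc D (c i) (c' j) ≤ g * g' := by
  classical
  let A : Finset (ZMod g × ZMod g') := Finset.univ.filter fun x => D.Adj (c x.1) (c' x.2)
  have hA : ∑ i, ∑ j, arc D (c i) (c' j) = A.card := by
    rw [Finset.card_filter, Fintype.sum_prod_type]
    rfl
  have hcard : (Finset.range k ×ˢ A).card ≤ (Finset.univ : Finset (ZMod g × ZMod g')).card := by
    -- The `k` diagonal translates of the arc set are pairwise disjoint in the torus `ZMod g × ZMod
    -- g'`: an overlap would be two crossings differing by some `0 < s < k`.
    refine Finset.card_le_card_of_injOn (fun x => (x.2.1 + x.1, x.2.2 + x.1)) (by simp) ?_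
    have key : ∀ s t : ℕ, s < k → t < k → ∀ x ∈ A, ∀ y ∈ A, x.1 + s = y.1 + t →
        x.2 + s = y.2 + t → ¬ s < t := by
      intro s t hs ht x hx y hy h1 h2 hst
      refine cycle_cycle_not_adj hD hc hc' hne (s := t - s) (by omega) (by omega)
        (Finset.mem_filter.1 hy).2 ?_
      have e1 : y.1 + ((t - s : ℕ) : ZMod g) = x.1 := by
        rw [Nat.cast_sub hst.le]; linear_combination -h1
      have e2 : y.2 + ((t - s : ℕ) : ZMod g') = x.2 := by
        rw [Nat.cast_sub hst.le]; linear_combination -h2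
      rw [e1, e2]
      exact (Finset.mem_filter.1 hx).2
    rintro ⟨s, x⟩ hx ⟨t, y⟩ hy h
    simp only [Finset.coe_product, Set.mem_prod, Finset.mem_coe, Finset.mem_range] at hx hy
    simp only [Prod.mk.injEq] at h
    have e : s = t := by
      have h3 := key s t hx.1 hy.1 x hx.2 y hy.2 h.1 h.2
      have h4 := key t s hy.1 hx.1 y hy.2 x hx.2 h.1.symm h.2.symm
      omega
    subst e
    simp only [add_left_inj] at h
    exact Prod.ext rfl (Prod.ext h.1 h.2)
  rw [Finset.card_product, Finset.card_range] at hcard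
  rw [hA]
  simpa [ZMod.card] using hcard

theorem mul_sum_cycleDeg_cycle_le (hD : WalkFree k D) {g g' : ℕ} [NeZero g] [NeZero g']
    {c : ZMod g → V} {c' : ZMod g' → V} (hc : ∀ i, D.Adj (c i) (c (i + 1)))
    (hc' : ∀ i, D.Adj (c' i) (c' (i + 1))) (hne : ∀ i j, c i ≠ c' j) :
    k * ∑ j, cycleDeg D c (c' j) ≤ 2 * (g * g') := by
  have h1 := mul_arcs_cycle_cycle_le hD hc hc' hne
  have h2 := mul_arcs_cycle_cycle_le hD hc' hc fun i j => (hne j i).symm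
  have : ∑ j, cycleDeg D c (c' j) =
      ∑ i, ∑ j, arc D (c i) (c' j) + ∑ i, ∑ j, arc D (c' i) (c j) := by
    unfold cycleDeg
    simp only [Finset.sum_add_distrib]
    rw [Finset.sum_comm]
  rw [this]
  nlinarith

/-- Arcs in a digraph without loops and 2-cycles in which `X` and `Y` are disjoint independent
sets. -/
theorem two_mul_arcsIn_add_le [DecidableEq V] {S X Y : Finset V}
    (h2 : ∀ u ∈ S, ∀ v ∈ S, D.Adj u v → ¬ D.Adj v u) (hX : X ⊆ S) (hY : Y ⊆ S)
    (hXY : Disjoint X Y) (hXi : ∀ u ∈ X, ∀ v ∈ X, ¬ D.Adj u v)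
    (hYi : ∀ u ∈ Y, ∀ v ∈ Y, ¬ D.Adj u v) :
    2 * arcsIn D S + S.card + X.card * X.card + Y.card * Y.card
      ≤ S.card * S.card + X.card + Y.card := by
  have e1 : arcsIn D S = ∑ u ∈ S, ∑ v ∈ S, arc D v u := Finset.sum_comm
  have e2 : ∀ Z ⊆ S, Z.card * Z.card =
      ∑ u ∈ S, ∑ v ∈ S, (if u ∈ Z then 1 else 0) * (if v ∈ Z then 1 else 0) := by
    intro Z hZ
    rw [← Finset.sum_mul_sum]
    simp [Finset.inter_eq_right.2 hZ]
  have e3 : ∀ Z ⊆ S, Z.card = ∑ u ∈ S, ∑ v ∈ S, if u = v then (if u ∈ Z then 1 else 0) else 0 := by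
    intro Z hZ
    simp [Finset.inter_eq_right.2 hZ]
  have e4 : S.card * S.card = ∑ u ∈ S, ∑ v ∈ S, 1 := by simp
  have e5 := e3 S subset_rfl
  rw [two_mul]
  nth_rw 2 [e1]
  rw [e2 X hX, e2 Y hY, e3 X hX, e3 Y hY, e4, e5]
  unfold arcsIn
  simp only [← Finset.sum_add_distrib]
  refine Finset.sum_le_sum fun u hu => Finset.sum_le_sum fun v hv => ?_
  have hd := Finset.disjoint_left.1 hXY
  have a1 := arc_le_one (D := D) u v
  have a2 := arc_le_one (D := D) v u
  have a3 : arc D u v + arc D v u ≤ 1 := by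
    by_cases h : D.Adj u v
    · have := arc_eq_zero.2 (h2 u hu v hv h)
      omega
    · have := arc_eq_zero.2 h
      omega
  by_cases huX : u ∈ X
  · have huY := hd huX
    by_cases hvX : v ∈ X
    · have b1 := arc_eq_zero.2 (hXi u huX v hvX)
      have b2 := arc_eq_zero.2 (hXi v hvX u huX)
      simp only [huX, huY, hvX, hu, b1, b2, if_true, if_false]
      split_ifs <;> omega
    · have huv : u ≠ v := fun e => hvX (e ▸ huX)
      simp only [huX, huY, hvX, hu, huv, if_true, if_false]
      omega
  · by_cases huv : u = v
    · subst huv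
      by_cases huY : u ∈ Y
      · have b1 := arc_eq_zero.2 (hYi u huY u huY)
        simp only [huX, huY, hu, b1, if_true, if_false]
        omega
      · simp only [huX, huY, hu, if_true, if_false]
        omega
    · by_cases huY : u ∈ Y
      · by_cases hvY : v ∈ Y
        · have b1 := arc_eq_zero.2 (hYi u huY v hvY)
          have b2 := arc_eq_zero.2 (hYi v hvY u huY)
          simp only [huX, huY, hvY, hu, huv, b1, b2, if_true, if_false]
          omega
        · simp only [huX, huY, hvY, hu, huv, if_true, if_false]
          omega
      · simp only [huX, huY, hu, huv, if_true, if_false]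
        omega

/-! ### The arc bound in the presence of a closed walk. -/

theorem hasClosedWalk_two {S : Finset V} {u v : V} (hu : u ∈ S) (hv : v ∈ S) (huv : D.Adj u v)
    (hvu : D.Adj v u) : HasClosedWalk D S 2 := by
  refine ⟨fun i : Fin 2 => ![u, v] i, ?_, ?_⟩
  · intro i
    change Fin 2 at i
    fin_cases i <;> simpa
  · intro i
    change Fin 2 at i
    fin_cases i <;> simpa

theorem hasClosedWalk_one {S : Finset V} {u : V} (hu : u ∈ S) (huu : D.Adj u u) :
    HasClosedWalk D S 1 := ⟨fun _ => u, fun _ => hu, fun _ => huu⟩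

/-- One step of the induction: removing an induced cycle with enough nonadjacent pairs between
it and the rest. -/
theorem arcsIn_bound_of_sdiff [DecidableEq V] {g : ℕ} [NeZero g] {c : ZMod g → V} {S : Finset V}
    (hS : ∀ i, c i ∈ S) (hinj : Function.Injective c)
    (hc : ∀ i j, D.Adj (c i) (c j) ↔ j = i + 1)
    (ih : 2 * arcsIn D (S \ Finset.univ.image c) + 2 * max (S \ Finset.univ.image c).card 3
      + (S \ Finset.univ.image c).card
      ≤ (S \ Finset.univ.image c).card * (S \ Finset.univ.image c).card + 8)
    (hμ : 2 * ∑ v ∈ S \ Finset.univ.image c, cycleDeg D c v + 5 * g ≤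
      2 * ((S \ Finset.univ.image c).card * g) + g * g) :
    2 * arcsIn D S + 2 * max S.card 3 + S.card ≤ S.card * S.card + 8 := by
  have h1 := arcsIn_eq_add_cycle hS hinj hc
  have hsub : Finset.univ.image c ⊆ S := by
    intro x hx
    obtain ⟨i, -, rfl⟩ := Finset.mem_image.1 hx
    exact hS i
  have hcard : S.card = (S \ Finset.univ.image c).card + g := by
    rw [← Finset.card_sdiff_add_card_eq_card hsub, Finset.card_image_of_injective _ hinj]
    simp [ZMod.card]
  set m := (S \ Finset.univ.image c).card
  rw [h1, hcard]
  have : max (m + g) 3 ≤ max m 3 + g := by omega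
  nlinarith

/-- Off the cycle each pair carries at most one arc. If `g ≥ 2`, vertices with the full number `g`
of arcs to the cycle form an independent set, while every other vertex loses an arc to the cycle. If
the cycle is a loop, its out-neighbours and its in-neighbours form two disjoint independent sets.
Either loss suffices. -/
theorem arcsIn_bound_acyclic_sdiff [DecidableEq V] (hD : WalkFree k D) (hk : 5 ≤ k)
    {g : ℕ} [NeZero g] {c : ZMod g → V} {S : Finset V}
    (hS : ∀ i, c i ∈ S) (hinj : Function.Injective c)
    (hc : ∀ i j, D.Adj (c i) (c j) ↔ j = i + 1)
    (hac : ∀ u ∈ S \ Finset.univ.image c, ∀ v ∈ S \ Finset.univ.image c,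
      D.Adj u v → ¬ D.Adj v u) :
    2 * arcsIn D S + 2 * max S.card 3 + S.card ≤ S.card * S.card + 8 := by
  classical
  have hk2 : 2 ≤ k := by omega
  have hcc : ∀ i, D.Adj (c i) (c (i + 1)) := fun i => (hc _ _).2 rfl
  have h1 := arcsIn_eq_add_cycle hS hinj hc
  have hsub : Finset.univ.image c ⊆ S := by
    intro x hx
    obtain ⟨i, -, rfl⟩ := Finset.mem_image.1 hx
    exact hS i
  have hcard : S.card = (S \ Finset.univ.image c).card + g := by
    rw [← Finset.card_sdiff_add_card_eq_card hsub, Finset.card_image_of_injective _ hinj]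
    simp [ZMod.card]
  have hout : ∀ v ∈ S \ Finset.univ.image c, ∀ i, c i ≠ v := by
    intro v hv i hi
    exact (Finset.mem_sdiff.1 hv).2 (Finset.mem_image.2 ⟨i, Finset.mem_univ _, hi⟩)
  set T := S \ Finset.univ.image c with hT
  rw [h1, hcard]
  have hg0 : 0 < g := Nat.pos_of_ne_zero (NeZero.ne g)
  obtain hg | rfl : 2 ≤ g ∨ g = 1 := by omega
  · let F := T.filter fun v => cycleDeg D c v = g
    have hFT : F ⊆ T := Finset.filter_subset _ _
    have hF := two_mul_arcsIn_add_le (X := F) (Y := ∅) hac hFT (by simp) (by simp)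
      (fun u hu v hv => not_adj_of_cycleDeg_eq hD (by omega) hg hinj hcc
        (hout u (hFT hu)) (hout v (hFT hv)) (Finset.mem_filter.1 hu).2 (Finset.mem_filter.1 hv).2)
      (by simp)
    have hsum : ∑ v ∈ T, cycleDeg D c v + T.card ≤ T.card * g + F.card := by
      have e1 : F.card = ∑ v ∈ T, if cycleDeg D c v = g then 1 else 0 := by
        rw [← Finset.card_filter]
      have e2 : T.card * g = ∑ v ∈ T, g := by simp
      have e3 : T.card = ∑ v ∈ T, 1 := by simp
      rw [e1, e2, e3]
      rw [← Finset.sum_add_distrib, ← Finset.sum_add_distrib]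
      refine Finset.sum_le_sum fun v hv => ?_
      have := cycleDeg_le hD hk2 hcc (hout v hv)
      split_ifs <;> omega
    simp only [Finset.card_empty] at hF
    have hfm := Finset.card_le_card hFT
    generalize F.card = f at *
    generalize T.card = m at *
    have hf : 3 * f ≤ f * f + 2 := by
      obtain _ | _ | f := f
      · omega
      · omega
      · nlinarith
    have hg' : 5 * g ≤ g * g + 6 := by
      obtain ⟨g, rfl⟩ : ∃ l, g = l + 2 := ⟨g - 2, by omega⟩
      rcases g with _ | g
      · omega
      · nlinarith
    rcases le_total 3 (m + g) with h | h
    · rw [max_eq_left h]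
      nlinarith
    · rw [max_eq_right h]
      rcases (by omega : g = 2 ∧ m = 0 ∨ g = 2 ∧ m = 1 ∨ g = 3 ∧ m = 0) with
        ⟨rfl, rfl⟩ | ⟨rfl, rfl⟩ | ⟨rfl, rfl⟩
      · nlinarith
      · nlinarith
      · nlinarith
  · let X := T.filter fun v => D.Adj (c 0) v
    let Y := T.filter fun v => D.Adj v (c 0)
    have hXT : X ⊆ T := Finset.filter_subset _ _
    have hYT : Y ⊆ T := Finset.filter_subset _ _
    have hXY : Disjoint X Y := by
      rw [Finset.disjoint_left]
      intro v hv hv'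
      refine cycle_not_adj_two hD hk2 hcc (hout v (hXT hv)) (Finset.mem_filter.1 hv).2 ?_
      rw [Subsingleton.elim (0 + 2 : ZMod 1) 0]
      exact (Finset.mem_filter.1 hv').2
    have hF := two_mul_arcsIn_add_le (X := X) (Y := Y) hac hXT hYT hXY
      (fun u hu v hv huv => by
        refine cycle_not_adj_out hD hk2 hcc (hout u (hXT hu)) huv (Finset.mem_filter.1 hu).2 ?_
        rw [Subsingleton.elim (0 + 1 : ZMod 1) 0]
        exact (Finset.mem_filter.1 hv).2)
      (fun u hu v hv huv => by
        refine cycle_not_adj_in hD hk2 hcc (hout v (hYT hv)) huv (Finset.mem_filter.1 hu).2 ?_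
        rw [Subsingleton.elim (0 + 1 : ZMod 1) 0]
        exact (Finset.mem_filter.1 hv).2)
    have hsum : ∑ v ∈ T, cycleDeg D c v = X.card + Y.card := by
      rw [Finset.card_filter, Finset.card_filter, ← Finset.sum_add_distrib]
      refine Finset.sum_congr rfl fun v _ => ?_
      unfold cycleDeg arc
      rw [Fintype.sum_subsingleton _ 0]
    have hle : X.card + Y.card ≤ T.card := by
      rw [← Finset.card_union_of_disjoint hXY]
      exact Finset.card_le_card (Finset.union_subset hXT hYT)
    rw [hsum]
    generalize X.card = x at *
    generalize Y.card = y at *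
    generalize T.card = m at *
    have quad : ∀ z : ℕ, 3 * z ≤ z * z + 2 := by
      intro z
      obtain _ | _ | z := z
      · omega
      · omega
      · nlinarith
    have hx := quad x
    have hy := quad y
    rcases le_total 3 (m + 1) with h | h
    · rw [max_eq_left h]
      nlinarith
    · rw [max_eq_right h]
      have : x ≤ 2 := by omega
      have : y ≤ 2 := by omega
      have : m ≤ 2 := by omega
      interval_cases m <;> interval_cases x <;> interval_cases y <;> omega

theorem not_adj_loops (hD : WalkFree k D) (hk : 2 ≤ k) {a b : V} (hab : a ≠ b) (haa : D.Adj a a)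
    (hbb : D.Adj b b) : ¬ D.Adj a b := fun h =>
  cycle_cycle_not_adj hD (c := fun _ : ZMod 1 => a) (c' := fun _ : ZMod 1 => b) (fun _ => haa)
    (fun _ => hbb) (fun _ _ => hab) (a := 0) (b := 0) (s := 1) one_pos (by omega) h h

theorem not_adj_loops_through (hD : WalkFree k D) (hk : 3 ≤ k) {a b v : V} (hav : a ≠ v)
    (haa : D.Adj a a) (hbb : D.Adj b b) (h1 : D.Adj a v) : ¬ D.Adj v b := by
  intro h2
  have := hD.eq_of_walks (p := fun t => if t = 0 then a else if t = 1 then v else b)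
    (q := fun t => if t ≤ 1 then a else if t = 2 then v else b) ?_ ?_ (by simp)
    (by rw [if_neg (by omega), if_neg (by omega), if_neg (by omega), if_neg (by omega)]) 1
    (by omega)
  · exact hav (by simpa using this.symm)
  · intro t _
    rcases t with _ | _ | t
    · simpa
    · simpa
    · simpa
  · intro t _
    rcases t with _ | _ | _ | t
    · simpa
    · simpa
    · simpa
    · simpa

theorem not_adj_two_loops (hD : WalkFree k D) (hk : 2 ≤ k) {a b v w : V} (hab : a ≠ b)
    (haa : D.Adj a a) (hbb : D.Adj b b) (hav : D.Adj a v) (hbv : D.Adj b v) (hwa : D.Adj w a) :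
    ¬ D.Adj w b := by
  intro hwb
  have key : ∀ x, D.Adj x x → D.Adj x v → D.Adj w x → ∀ t < k,
      D.Adj (if t = 0 then w else if t = k then v else x)
        (if t + 1 = 0 then w else if t + 1 = k then v else x) := by
    intro x hxx hxv hwx t ht
    rcases t with _ | t
    · rw [if_pos rfl, if_neg (by omega), if_neg (by omega)]
      exact hwx
    · rw [if_neg (by omega), if_neg (by omega), if_neg (by omega)]
      split_ifs
      · exact hxv
      · exact hxx
  have := hD.eq_of_walks (key a haa hav hwa) (key b hbb hbv hwb) (by simp)
    (by simp) 1 (by omega)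
  rw [if_neg (by omega), if_neg (by omega), if_neg (by omega), if_neg (by omega)] at this
  exact hab this

theorem arcsIn_eq_add_loop [DecidableEq V] {S : Finset V} {a : V} (ha : a ∈ S)
    (haa : D.Adj a a) :
    arcsIn D S = 1 + ∑ v ∈ S.erase a, cycleDeg D (fun _ : ZMod 1 => a) v
      + arcsIn D (S.erase a) := by
  have := arcsIn_eq_add_cycle (D := D) (c := fun _ : ZMod 1 => a) (S := S) (fun _ => ha)
    (fun _ _ _ => Subsingleton.elim _ _)
    (fun _ _ => ⟨fun _ => Subsingleton.elim _ _, fun _ => haa⟩)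
  rwa [show Finset.univ.image (fun _ : ZMod 1 => a) = {a} by
    ext; simp [eq_comm], Finset.sdiff_singleton_eq_erase] at this

theorem cycleDeg_loop_eq_zero {a b : V} (h1 : ¬ D.Adj a b) (h2 : ¬ D.Adj b a) :
    cycleDeg D (fun _ : ZMod 1 => a) b = 0 := by
  unfold cycleDeg
  rw [Fintype.sum_subsingleton _ 0, arc_eq_zero.2 h1, arc_eq_zero.2 h2]

/-- Every other vertex is joined to both loops, and in the same direction, since `a → v → b` is
impossible. This forbids all arcs among the other vertices, so the number of arcs is only linear. -/
theorem arcsIn_bound_two_loops [DecidableEq V] (hD : WalkFree k D) (hk : 5 ≤ k)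
    {S : Finset V} {a b : V} (ha : a ∈ S) (hb : b ∈ S) (hab : a ≠ b) (haa : D.Adj a a)
    (hbb : D.Adj b b) (hda : ∀ v ∈ S, v ≠ a → v ≠ b → D.Adj a v ∨ D.Adj v a)
    (hdb : ∀ v ∈ S, v ≠ a → v ≠ b → D.Adj b v ∨ D.Adj v b) :
    2 * arcsIn D S + 2 * max S.card 3 + S.card ≤ S.card * S.card + 8 := by
  have hk2 : 2 ≤ k := by omega
  have hk3 : 3 ≤ k := by omega
  have hbS : b ∈ S.erase a := Finset.mem_erase.2 ⟨hab.symm, hb⟩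
  set T := (S.erase a).erase b with hT
  have hmem : ∀ v ∈ T, v ≠ b ∧ v ≠ a ∧ v ∈ S := fun v hv => by
    simpa [hT] using hv
  have htype : ∀ v ∈ T, D.Adj a v ∧ D.Adj b v ∨ D.Adj v a ∧ D.Adj v b := by
    intro v hv
    obtain ⟨h1, h2, h3⟩ := hmem v hv
    rcases hda v h3 h2 h1 with h4 | h4 <;> rcases hdb v h3 h2 h1 with h5 | h5
    · exact .inl ⟨h4, h5⟩
    · exact absurd h5 (not_adj_loops_through hD hk3 h2.symm haa hbb h4)
    · exact absurd h4 (not_adj_loops_through hD hk3 h1.symm hbb haa h5)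
    · exact .inr ⟨h4, h5⟩
  have hind : ∀ v ∈ T, ∀ w ∈ T, ¬ D.Adj v w := by
    intro v hv w hw hvw
    rcases htype v hv with ⟨h1, h2⟩ | ⟨h1, h2⟩ <;> rcases htype w hw with ⟨h3, h4⟩ | ⟨h3, h4⟩
    · exact cycle_not_adj_out hD hk2 (c := fun _ : ZMod 1 => a) (fun _ => haa)
        (fun _ => (hmem v hv).2.1.symm) hvw (i := 0) h1 h3
    · exact not_adj_two_loops hD hk2 hab haa hbb h1 h2 h3 h4
    · exact not_adj_two_loops hD hk2 hab haa hbb h3 h4 h1 h2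
    · exact cycle_not_adj_in hD hk2 (c := fun _ : ZMod 1 => a) (fun _ => haa)
        (fun _ => (hmem w hw).2.1.symm) hvw (i := 0) h1 h3
  have e1 := arcsIn_eq_add_loop ha haa
  have e2 := arcsIn_eq_add_loop hbS hbb
  have e3 : arcsIn D T = 0 :=
    Finset.sum_eq_zero fun u hu => Finset.sum_eq_zero fun v hv => arc_eq_zero.2 (hind u hu v hv)
  rw [← hT, e3] at e2
  rw [← Finset.add_sum_erase _ _ hbS, ← hT, cycleDeg_loop_eq_zero
    (not_adj_loops hD hk2 hab haa hbb) (not_adj_loops hD hk2 hab.symm hbb haa)] at e1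
  have hle : ∀ x, D.Adj x x → (∀ v ∈ T, x ≠ v) →
      ∑ v ∈ T, cycleDeg D (fun _ : ZMod 1 => x) v ≤ T.card := by
    intro x hxx hx
    calc _ ≤ ∑ v ∈ T, 1 := Finset.sum_le_sum fun v hv =>
          cycleDeg_le hD hk2 (fun _ => hxx) fun _ => hx v hv
      _ = _ := by simp
  have l1 := hle a haa fun v hv => (hmem v hv).2.1.symm
  have l2 := hle b hbb fun v hv => (hmem v hv).1.symm
  have hcard : S.card = T.card + 2 := by
    have := Finset.card_erase_add_one ha
    have : T.card + 1 = _ := Finset.card_erase_add_one hbS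
    omega
  generalize T.card = t at *
  rw [hcard]
  rcases t with _ | t
  · rw [max_eq_right (by omega)]
    omega
  · rw [max_eq_left (by omega)]
    rcases t with _ | t
    · omega
    · nlinarith

/-- Deleting the loop `a` costs two nonadjacent pairs, with `b` and with `v`, which is what
`arcsIn_bound_of_sdiff` needs for `g = 1`. -/
theorem arcsIn_bound_loop_step [DecidableEq V] (hD : WalkFree k D) (hk : 2 ≤ k)
    {S : Finset V} {a b v : V} (ha : a ∈ S) (hb : b ∈ S) (hv : v ∈ S) (hab : a ≠ b) (hva : v ≠ a)
    (hvb : v ≠ b) (haa : D.Adj a a) (hbb : D.Adj b b) (hav : ¬ (D.Adj a v ∨ D.Adj v a))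
    (ih : ∀ T ⊂ S, (∃ g, 0 < g ∧ HasClosedWalk D T g) →
      2 * arcsIn D T + 2 * max T.card 3 + T.card ≤ T.card * T.card + 8) :
    2 * arcsIn D S + 2 * max S.card 3 + S.card ≤ S.card * S.card + 8 := by
  push Not at hav
  have himg : Finset.univ.image (fun _ : ZMod 1 => a) = {a} := by
    ext; simp [eq_comm]
  have hb' : b ∈ S.erase a := Finset.mem_erase.2 ⟨hab.symm, hb⟩
  have hv' : v ∈ (S.erase a).erase b := Finset.mem_erase.2 ⟨hvb, Finset.mem_erase.2 ⟨hva, hv⟩⟩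
  refine arcsIn_bound_of_sdiff (c := fun _ : ZMod 1 => a) (fun _ => ha)
    (fun _ _ _ => Subsingleton.elim _ _)
    (fun _ _ => ⟨fun _ => Subsingleton.elim _ _, fun _ => haa⟩) ?_ ?_ <;>
    rw [himg, Finset.sdiff_singleton_eq_erase]
  · exact ih _ (Finset.erase_ssubset ha) ⟨1, one_pos, hasClosedWalk_one hb' hbb⟩
  · rw [← Finset.add_sum_erase _ _ hb', ← Finset.add_sum_erase _ _ hv',
      cycleDeg_loop_eq_zero (not_adj_loops hD hk hab haa hbb)
        (not_adj_loops hD hk hab.symm hbb haa), cycleDeg_loop_eq_zero hav.1 hav.2,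
      ← Finset.card_erase_add_one hb', ← Finset.card_erase_add_one hv']
    have : ∑ w ∈ ((S.erase a).erase b).erase v, cycleDeg D (fun _ : ZMod 1 => a) w
        ≤ (((S.erase a).erase b).erase v).card := by
      calc _ ≤ ∑ w ∈ ((S.erase a).erase b).erase v, 1 := Finset.sum_le_sum fun w hw =>
            cycleDeg_le hD hk (fun _ => haa) fun _ h => by simp [h] at hw
        _ = _ := by simp
    omega

/-- Here `s'` counts the arcs between the two cycles. For `g ≥ 5` the term `g * g` alone pays for `5
* g`. Two loops are excluded because they supply one nonadjacent pair where two are needed. -/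
theorem cycle_missing_arith {g g' m s s' : ℕ} (hg : 0 < g) (hgg : g ≤ g')
    (h11 : ¬ (g = 1 ∧ g' = 1)) (hsum : s + g' * g ≤ m * g + s') (h5 : 5 * s' ≤ 2 * (g * g')) :
    2 * s + 5 * g ≤ 2 * (m * g) + g * g := by
  rcases lt_or_ge g 5 with h | h
  · interval_cases g <;> omega
  · nlinarith

/-- The number of arcs of a digraph with a closed walk and without two walks of length `k ≥ 5`
with the same endpoints. -/
theorem arcsIn_bound_of_closedWalk (hD : WalkFree k D) (hk : 5 ≤ k) (S : Finset V)
    (hS : ∃ g, 0 < g ∧ HasClosedWalk D S g) :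
    2 * arcsIn D S + 2 * max S.card 3 + S.card ≤ S.card * S.card + 8 := by
  classical
  -- The maximum with `3` matters only for `S.card ≤ 2`, where the bound says that there are at most
  -- `S.card` arcs.
  induction S using Finset.strongInduction with
  | H S ih =>
  have hk2 : 2 ≤ k := by omega
  obtain ⟨g, _, c, hcS, hinj, hc, hmin⟩ := exists_induced_cycle hS
  have hcc : ∀ i, D.Adj (c i) (c (i + 1)) := fun i => (hc _ _).2 rfl
  have hout : ∀ v ∈ S \ Finset.univ.image c, ∀ i, c i ≠ v := by
    intro v hv i hi
    exact (Finset.mem_sdiff.1 hv).2 (Finset.mem_image.2 ⟨i, Finset.mem_univ _, hi⟩)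
  by_cases hT : ∃ g, 0 < g ∧ HasClosedWalk D (S \ Finset.univ.image c) g
  swap
  · exact arcsIn_bound_acyclic_sdiff hD hk hcS hinj hc fun u hu v hv huv hvu =>
      hT ⟨2, two_pos, hasClosedWalk_two hu hv huv hvu⟩
  have hlt : ∀ x ∈ S, ∀ S' ⊆ S, x ∉ S' → S' ⊂ S := fun x hx S' hS' hxS' =>
    Finset.ssubset_iff_subset_ne.2 ⟨hS', fun e => hxS' (e ▸ hx)⟩
  have ihT := ih _ (hlt (c 0) (hcS 0) _ Finset.sdiff_subset (by simp)) hT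
  obtain ⟨g', _, c', hcS', hinj', hc', -⟩ := exists_induced_cycle hT
  have hcc' : ∀ i, D.Adj (c' i) (c' (i + 1)) := fun i => (hc' _ _).2 rfl
  have hgg : g ≤ g' := hmin g' (Nat.pos_of_ne_zero (NeZero.ne g'))
    ⟨c', fun i => (Finset.mem_sdiff.1 (hcS' i)).1, hcc'⟩
  have hg0 : 0 < g := Nat.pos_of_ne_zero (NeZero.ne g)
  have hfew := mul_sum_cycleDeg_cycle_le hD hcc hcc' fun i j => hout _ (hcS' j) i
  have hsub : Finset.univ.image c' ⊆ S \ Finset.univ.image c := by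
    intro x hx
    obtain ⟨i, -, rfl⟩ := Finset.mem_image.1 hx
    exact hcS' i
  have hsum : ∑ v ∈ S \ Finset.univ.image c, cycleDeg D c v + g' * g
      ≤ (S \ Finset.univ.image c).card * g + ∑ j, cycleDeg D c (c' j) := by
    have e1 : ∑ v ∈ (S \ Finset.univ.image c) \ Finset.univ.image c', cycleDeg D c v ≤
        ((S \ Finset.univ.image c) \ Finset.univ.image c').card * g := by
      rw [← smul_eq_mul]
      exact Finset.sum_le_card_nsmul _ _ _ fun v hv =>
        cycleDeg_le hD hk2 hcc (hout v (Finset.mem_sdiff.1 hv).1)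
    rw [← Finset.sum_sdiff hsub, Finset.sum_image hinj'.injOn,
      ← Finset.card_sdiff_add_card_eq_card hsub, Finset.card_image_of_injective _ hinj',
      Finset.card_univ, ZMod.card]
    linarith
  by_cases h11 : g = 1 ∧ g' = 1
  swap
  · exact arcsIn_bound_of_sdiff hcS hinj hc ihT (cycle_missing_arith hg0 hgg h11 hsum
      (le_trans (Nat.mul_le_mul_right _ hk) hfew))
  obtain ⟨rfl, rfl⟩ := h11
  have haa := hcc 0
  have hbb := hcc' 0
  rw [Subsingleton.elim (0 + 1 : ZMod 1) 0] at haa hbb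
  have hb : c' 0 ∈ S := (Finset.mem_sdiff.1 (hcS' 0)).1
  have hab : c 0 ≠ c' 0 := hout _ (hcS' 0) 0
  by_cases hda : ∀ v ∈ S, v ≠ c 0 → v ≠ c' 0 → D.Adj (c 0) v ∨ D.Adj v (c 0)
  · by_cases hdb : ∀ v ∈ S, v ≠ c 0 → v ≠ c' 0 → D.Adj (c' 0) v ∨ D.Adj v (c' 0)
    · exact arcsIn_bound_two_loops hD hk (hcS 0) hb hab haa hbb hda hdb
    · push Not at hdb
      obtain ⟨v, hv, h1, h2, h3⟩ := hdb
      exact arcsIn_bound_loop_step hD hk2 hb (hcS 0) hv hab.symm h2 h1 hbb haa (by tauto) ih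
  · push Not at hda
    obtain ⟨v, hv, h1, h2, h3⟩ := hda
    exact arcsIn_bound_loop_step hD hk2 (hcS 0) hb hv hab h1 h2 haa hbb (by tauto) ih

end Walk

/-! ### Heights in a digraph without closed walks. -/

section Height

variable {V : Type*} {D : Digraph V} {k : ℕ}

theorem wellFounded_adj_of_no_closedWalk [Fintype V]
    (h : ∀ g, 0 < g → ¬ HasClosedWalk D Finset.univ g) : WellFounded D.Adj := by
  rw [wellFounded_iff_isEmpty_descending_chain]
  refine ⟨fun ⟨f, hf⟩ => ?_⟩
  have : ∃ a b, a < b ∧ f a = f b := by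
    obtain ⟨a, b, hab, hne⟩ := Finite.exists_ne_map_eq_of_infinite f
    rcases lt_or_gt_of_ne hab with h | h
    · exact ⟨a, b, h, hne⟩
    · exact ⟨b, a, h, hne.symm⟩
  obtain ⟨a, b, hab, hfab⟩ := this
  have : NeZero (b - a) := ⟨by omega⟩
  -- The chain descends along reversed arcs, so it is traversed backwards from `b` to `a`.
  refine h (b - a) (by omega) ⟨fun x => f (b - x.val), fun _ => Finset.mem_univ _, fun x => ?_⟩
  have hx := ZMod.val_lt x
  simp only [zmod_val_add_one]
  split_ifs with h1
  · have := hf a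
    rw [hfab] at this
    convert this using 2 <;> omega
  · have := hf (b - (x.val + 1))
    convert this using 2
    omega

/-- A height function: the height of a vertex is the length of a longest walk ending there. -/
structure IsHeight (D : Digraph V) (h : V → ℕ) : Prop where
  lt : ∀ {u v}, D.Adj u v → h u < h v
  exists_pred : ∀ {v l}, h v = l + 1 → ∃ u, D.Adj u v ∧ h u = l

theorem exists_isHeight [Fintype V] (hwf : WellFounded D.Adj) : ∃ h, IsHeight D h := by
  classical
  let F : ∀ v, (∀ u, D.Adj u v → ℕ) → ℕ := fun v ih =>
    Finset.univ.sup fun u => if hu : D.Adj u v then ih u hu + 1 else 0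
  have heq : ∀ v, hwf.fix F v = Finset.univ.sup fun u => if D.Adj u v then hwf.fix F u + 1 else 0 := by
    intro v
    rw [hwf.fix_eq]
    rfl
  refine ⟨hwf.fix F, @fun u v huv => ?_, @fun v l hl => ?_⟩
  · rw [heq v]
    have := Finset.le_sup (f := fun u => if D.Adj u v then hwf.fix F u + 1 else 0)
      (Finset.mem_univ u)
    simp only [if_pos huv] at this
    omega
  · rw [heq v] at hl
    obtain ⟨u, -, hu⟩ := Finset.exists_mem_eq_sup Finset.univ ⟨v, Finset.mem_univ _⟩
      (fun u => if D.Adj u v then hwf.fix F u + 1 else 0)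
    rw [hl] at hu
    split_ifs at hu with h
    exact ⟨u, h, by omega⟩

theorem IsHeight.exists_walk {h : V → ℕ} (hh : IsHeight D h) (v : V) :
    ∃ w : ℕ → V, (∀ t ≤ h v, h (w t) = t) ∧ (∀ t < h v, D.Adj (w t) (w (t + 1))) ∧
      w (h v) = v := by
  generalize hl : h v = l
  induction l generalizing v with
  | zero => exact ⟨fun _ => v, by simpa using hl, by simp, rfl⟩
  | succ l ih =>
    obtain ⟨u, huv, hu⟩ := hh.exists_pred hl
    obtain ⟨w, h1, h2, h3⟩ := ih u hu
    refine ⟨fun t => if t ≤ l then w t else v, ?_, ?_, ?_⟩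
    · intro t ht
      simp only []
      split_ifs with h
      · exact h1 t h
      · omega
    · intro t ht
      simp only []
      rw [if_pos (by omega)]
      split_ifs with h
      · exact h2 t (by omega)
      · obtain rfl : t = l := by omega
        rwa [h3]
    · simp

theorem WalkFree.not_detour (hD : WalkFree k D) {w : ℕ → V}
    (hw : ∀ t < k, D.Adj (w t) (w (t + 1))) {p : ℕ} (hp : p + 2 ≤ k) {x : V}
    (hx : x ≠ w (p + 1)) (h1 : D.Adj (w p) x) : ¬ D.Adj x (w (p + 2)) := by
  intro h2
  have := hD.eq_of_walks hw (q := fun t => if t = p + 1 then x else w t) ?_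
    (by simp) (by rw [if_neg (by omega)]) (p + 1) (by omega)
  · exact hx (by simpa using this.symm)
  · intro t ht
    by_cases h : t = p
    · subst h
      simpa using h1
    · by_cases h' : t = p + 1
      · subst h'
        simpa using h2
      · rw [if_neg h', if_neg (by omega)]
        exact hw t ht

end Height

/-! ### Missing pairs, relabelling and permutation similarity. -/

section Labelled

variable {n k : ℕ} {D : Digraph (Fin n)}

open Classical in
/-- The pairs `i < j` that are not joined by an arc. -/
noncomputable def missing (D : Digraph (Fin n)) : Finset (Fin n × Fin n) :=
  Finset.univ.filter fun x => x.1 < x.2 ∧ ¬ D.Adj x.1 x.2 ∧ ¬ D.Adj x.2 x.1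

theorem mem_missing {i j : Fin n} :
    (i, j) ∈ missing D ↔ i < j ∧ ¬ D.Adj i j ∧ ¬ D.Adj j i := by
  simp [missing]

theorem size_eq_arcsIn {V : Type*} [Fintype V] (D : Digraph V) :
    size D = arcsIn D Finset.univ := by
  classical
  unfold size arcsIn
  rw [← Fintype.sum_prod_type', Set.ncard_eq_toFinset_card', Set.toFinset_ofPred,
    Finset.card_filter]
  rfl

theorem two_mul_size_add_missing (h : ∀ i j, D.Adj i j → ¬ D.Adj j i) :
    2 * size D + 2 * (missing D).card + n = n * n := by
  classical
  let f : Fin n → Fin n → ℕ := fun i j => if i < j ∧ ¬ D.Adj i j ∧ ¬ D.Adj j i then 1 else 0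
  have e1 : (missing D).card = ∑ i, ∑ j, f i j := by
    rw [missing, Finset.card_filter, Fintype.sum_prod_type]
  have e2 : ∑ i : Fin n, ∑ j : Fin n, (if i = j then 1 else 0) = n := by simp
  have e3 : ∑ i : Fin n, ∑ j : Fin n, 1 = n * n := by simp
  have key : ∀ i j, arc D i j + arc D j i + (f i j + f j i) + (if i = j then 1 else 0) = 1 := by
    intro i j
    have := h i j
    have := h j i
    simp only [f, arc]
    rcases lt_trichotomy i j with hij | rfl | hij
    · have h1 := hij.not_gt
      have h2 := hij.ne
      by_cases a : D.Adj i j <;> by_cases b : D.Adj j i <;> simp_all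
    · by_cases a : D.Adj i i <;> simp_all
    · have h1 := hij.not_gt
      have h2 := hij.ne'
      by_cases a : D.Adj i j <;> by_cases b : D.Adj j i <;> simp_all
  have e4 : arcsIn D Finset.univ = ∑ i, ∑ j, arc D j i := Finset.sum_comm
  have e5 : (missing D).card = ∑ i, ∑ j, f j i := by rw [e1, Finset.sum_comm]
  calc _ = arcsIn D Finset.univ + arcsIn D Finset.univ
        + ((missing D).card + (missing D).card) + n := by rw [size_eq_arcsIn]; ring
    _ = ∑ i, ∑ j, arc D i j + ∑ i, ∑ j, arc D j i
        + (∑ i, ∑ j, f i j + ∑ i, ∑ j, f j i)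
        + ∑ i : Fin n, ∑ j : Fin n, (if i = j then 1 else 0) := by
      rw [← e4, ← e5, ← e1, e2]; rfl
    _ = ∑ i : Fin n, ∑ j : Fin n, 1 := by
      simp only [← Finset.sum_add_distrib, key]
    _ = n * n := e3

/-- The digraph `D` with its vertices renamed by `σ`. -/
def relabel (D : Digraph (Fin n)) (σ : Equiv.Perm (Fin n)) : Digraph (Fin n) where
  Adj i j := D.Adj (σ i) (σ j)

theorem WalkFree.relabel (hD : WalkFree k D) (σ : Equiv.Perm (Fin n)) :
    WalkFree k (relabel D σ) := by
  rintro ⟨p, q, hp, hq, h0, hk, hne⟩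
  refine hD ⟨σ ∘ p, σ ∘ q, fun i => hp i, fun i => hq i, congrArg σ h0, congrArg σ hk, fun e => ?_⟩
  exact hne (funext fun i => σ.injective (congrFun e i))

theorem size_relabel (D : Digraph (Fin n)) (σ : Equiv.Perm (Fin n)) :
    size (relabel D σ) = size D := by
  rw [size_eq_arcsIn, size_eq_arcsIn]
  unfold arcsIn
  rw [← Equiv.sum_comp σ fun u => ∑ v, arc D u v]
  refine Finset.sum_congr rfl fun i _ => ?_
  rw [← Equiv.sum_comp σ fun v => arc D (σ i) v]
  rfl

theorem permSimilar_iff {A B : Matrix (Fin n) (Fin n) ℕ} :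
    PermSimilar A B ↔ ∃ σ : Equiv.Perm (Fin n), ∀ i j, B i j = A (σ i) (σ j) := by
  have key : ∀ σ : Equiv.Perm (Fin n), ∀ i j,
      (σ.permMatrix ℕ * A * (σ.permMatrix ℕ).transpose) i j = A (σ i) (σ j) := by
    intro σ i j
    simp [Matrix.mul_apply, Equiv.Perm.permMatrix, PEquiv.toMatrix_apply,
      Equiv.symm_apply_eq]
  constructor
  · rintro ⟨σ, rfl⟩
    exact ⟨σ, key σ⟩
  · rintro ⟨σ, h⟩
    exact ⟨σ, Matrix.ext fun i j => by rw [h, key]⟩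

theorem PermSimilar.of_relabel {σ : Equiv.Perm (Fin n)} {B : Matrix (Fin n) (Fin n) ℕ}
    (h : PermSimilar (adjMatrix (WalkTuran.relabel D σ)) B) : PermSimilar (adjMatrix D) B := by
  rw [permSimilar_iff] at *
  obtain ⟨τ, h⟩ := h
  exact ⟨τ.trans σ, h⟩

theorem permSimilar_of_injective {B : Matrix (Fin n) (Fin n) ℕ} (f : Fin n → Fin n)
    (hf : Function.Injective f) (h : ∀ i j, B (f i) (f j) = arc D i j) :
    PermSimilar (adjMatrix D) B := by
  rw [permSimilar_iff]
  let σ := Equiv.ofBijective f (Finite.injective_iff_bijective.1 hf)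
  refine ⟨σ.symm, fun i j => ?_⟩
  have := h (σ.symm i) (σ.symm j)
  have e : ∀ i, f (σ.symm i) = i := σ.apply_symm_apply
  rw [e, e] at this
  rw [this]
  rfl

end Labelled

/-! ### Skipped levels and levels with two vertices. -/

section Height

variable {V : Type*} {D : Digraph V} {k : ℕ} {h : V → ℕ}

/-- On a walk `w` through the levels, at most one of the arcs `w t → w (t + 2)` with `t` in a window
of length `k` can be present. -/
theorem WalkFree.not_adj_skip (hD : WalkFree k D) {w : ℕ → V} {l : ℕ} (hl : k + 1 ≤ l)
    (hw : ∀ t < l, D.Adj (w t) (w (t + 1))) (hwh : ∀ t ≤ l, h (w t) = t) {s t : ℕ} (hst : s < t)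
    (htl : t + 2 ≤ l) (htk : t < s + k) (hs : D.Adj (w s) (w (s + 2))) :
    ¬ D.Adj (w t) (w (t + 2)) := by
  intro ht
  -- Choose `k + 1` consecutive steps of `w` containing both skips: start at `s`, or further left if
  -- that would overrun the end. Using either skip shortens this stretch to a walk of length `k`.
  obtain ⟨o, ho1, ho2, ho3⟩ : ∃ o, o ≤ s ∧ t < o + k ∧ o + k + 1 ≤ l := by
    rcases le_total (s + k + 1) l with h | h
    · exact ⟨s, le_rfl, htk, h⟩
    · exact ⟨l - k - 1, by omega, by omega, by omega⟩
  have key : ∀ r, r < o + k → D.Adj (w r) (w (r + 2)) → ∀ i < k,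
      D.Adj (w (if o + i ≤ r then o + i else o + i + 1))
        (w (if o + (i + 1) ≤ r then o + (i + 1) else o + (i + 1) + 1)) := by
    intro r hr hr' i hi
    split_ifs with h1 h2 h2
    · exact hw _ (by omega)
    · obtain rfl : r = o + i := by omega
      exact hr'
    · omega
    · exact hw _ (by omega)
  have := hD.eq_of_walks (key s (by omega) hs) (key t (by omega) ht)
    (by rw [if_pos (by omega), if_pos (by omega)])
    (by rw [if_neg (by omega), if_neg (by omega)]) (s + 1 - o) (by omega)
  rw [if_neg (by omega), if_pos (by omega)] at this
  have := congrArg h this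
  rw [hwh _ (by omega), hwh _ (by omega)] at this
  omega

/-- If all pairs of vertices on different levels but `(y, z)` are joined by arcs, then a level with
two vertices is extremal, or it is the level of `y`, just below `z`. -/
theorem IsHeight.eq_of_internal (hh : IsHeight D h) (hD : WalkFree k D) {v y z : V}
    (hv : h v = k) (hadj : ∀ i j, h i < h j → ¬ (i = y ∧ j = z) → D.Adj i j) {x x' : V}
    (hne : x ≠ x') {p : ℕ} (hx : h x = p + 1) (hx' : h x' = p + 1) (hp : p + 2 ≤ k) :
    h y = p + 1 ∧ h z = p + 2 ∧ (y = x ∨ y = x') ∧ ¬ D.Adj y z ∧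
      (p + 2 = k → ∀ z', h z' = k → z' = z) := by
  -- A second vertex `s` on level `p + 1` would give a detour of `w`, so one of its two arcs must be
  -- the exceptional pair, and that pair is not an arc.
  have detour : ∀ w : ℕ → V, (∀ t ≤ k, h (w t) = t) → (∀ t < k, D.Adj (w t) (w (t + 1))) →
      ∀ s, h s = p + 1 → s ≠ w (p + 1) →
        ¬ D.Adj y z ∧ ((w p = y ∧ s = z) ∨ (s = y ∧ w (p + 2) = z)) := by
    intro w hwh hw s hs hsw
    have e1 := hwh p (by omega)
    have e2 := hwh (p + 2) hp
    have hno := hD.not_detour hw hp hsw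
    by_cases c1 : w p = y ∧ s = z
    · refine ⟨fun hyz => ?_, .inl c1⟩
      refine hno (c1.1 ▸ c1.2 ▸ hyz) (hadj _ _ (by omega) fun c2 => ?_)
      have := congrArg h (c1.1.trans c2.1.symm)
      omega
    · have := hno (hadj _ _ (by omega) c1)
      by_cases c2 : s = y ∧ w (p + 2) = z
      · exact ⟨fun hyz => this (c2.1 ▸ c2.2 ▸ hyz), .inr c2⟩
      · exact absurd (hadj _ _ (by omega) c2) this
  have other : ∀ u : V, ∃ s, (s = x ∨ s = x') ∧ h s = p + 1 ∧ s ≠ u := by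
    intro u
    by_cases hu : x = u
    · exact ⟨x', .inr rfl, hx', fun e => hne (hu.trans e.symm)⟩
    · exact ⟨x, .inl rfl, hx, hu⟩
  have main : ∀ v, h v = k → h y = p + 1 ∧ h z = p + 2 ∧ (y = x ∨ y = x') ∧ ¬ D.Adj y z ∧
      (p + 2 = k → v = z) := by
    intro v hv
    obtain ⟨w, hwh, hw, hwv⟩ := hh.exists_walk v
    rw [hv] at hwh hw hwv
    obtain ⟨s, hsx, hs, hsw⟩ := other (w (p + 1))
    have e1 := hwh p (by omega)
    have e2 := hwh (p + 2) hp
    obtain ⟨hyz, ⟨c1, c2⟩ | ⟨c1, c2⟩⟩ := detour w hwh hw s hs hsw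
    -- If the blocked arc enters `s = z`, then `z` still has some predecessor `y' ≠ y` on level `p`.
    -- Rerouting `w` through `y'` makes the detour available again.
    · exfalso
      rw [c1] at e1
      rw [c2] at hs
      obtain ⟨y', hy'z, hy'⟩ := hh.exists_pred hs
      have hy'y : y' ≠ y := fun e => hyz (e ▸ hy'z)
      obtain ⟨w', hwh', hw', hwy'⟩ := hh.exists_walk y'
      rw [hy'] at hwh' hw' hwy'
      have hA : ∀ t ≤ k, h (if t ≤ p then w' t else w t) = t := by
        intro t ht
        split_ifs with ht'
        · exact hwh' t ht'
        · exact hwh t ht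
      have hB : ∀ t < k, D.Adj (if t ≤ p then w' t else w t)
          (if t + 1 ≤ p then w' (t + 1) else w (t + 1)) := by
        intro t ht
        rcases lt_trichotomy t p with htp | rfl | htp
        · rw [if_pos (by omega), if_pos (by omega)]
          exact hw' t htp
        · rw [if_pos le_rfl, if_neg (by omega), hwy']
          refine hadj _ _ ?_ fun e => hy'y e.1
          rw [hy', hwh _ (by omega)]
          omega
        · rw [if_neg (by omega), if_neg (by omega)]
          exact hw t ht
      obtain ⟨-, ⟨c3, -⟩ | ⟨c3, -⟩⟩ := detour _ hA hB s (c2 ▸ hs) (by simpa using hsw)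
      · simp only [le_refl, if_true, hwy'] at c3
        exact hy'y c3
      · have := congrArg h (c2.symm.trans c3)
        omega
    · refine ⟨c1 ▸ hs, c2 ▸ e2, c1 ▸ hsx, hyz, fun e => ?_⟩
      rw [← hwv, ← e, c2]
  obtain ⟨a1, a2, a3, a4, -⟩ := main v hv
  exact ⟨a1, a2, a3, a4, fun e z' hz' => (main z' hz').2.2.2.2 e⟩

end Height

/-! ### Acyclic digraphs with vertices sorted by height. -/

section Sorted

variable {n k : ℕ} {D : Digraph (Fin n)} {h : Fin n → ℕ}

theorem IsHeight.fin_lt (hh : IsHeight D h) (hm : Monotone h) {i j : Fin n} (hij : D.Adj i j) :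
    i < j := by
  by_contra hlt
  have := hm (not_lt.1 hlt)
  have := hh.lt hij
  omega

theorem IsHeight.mem_missing (hh : IsHeight D h) (hm : Monotone h) {i j : Fin n} :
    (i, j) ∈ missing D ↔ i < j ∧ ¬ D.Adj i j := by
  rw [WalkTuran.mem_missing]
  refine ⟨fun h => ⟨h.1, h.2.1⟩, fun h => ⟨h.1, h.2, fun hji => ?_⟩⟩
  exact (hh.fin_lt hm hji).not_gt h.1

/-- The positions `r` such that `r` and `r + 1` are on the same level. -/
def repeats (h : Fin n → ℕ) : Finset ℕ :=
  (Finset.range n).filter fun r => ∃ (hr : r + 1 < n), h ⟨r + 1, hr⟩ = h ⟨r, by omega⟩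

theorem mem_repeats {r : ℕ} :
    r ∈ repeats h ↔ ∃ (hr : r + 1 < n), h ⟨r + 1, hr⟩ = h ⟨r, by omega⟩ := by
  unfold repeats
  rw [Finset.mem_filter, Finset.mem_range]
  exact ⟨fun h => h.2, fun h => ⟨by have := h.1; omega, h⟩⟩

/-- No level is skipped, because a vertex of positive height has a predecessor one level lower. So
each step in the order raises the height by one or is a repeat. -/
theorem IsHeight.add_repeats (hh : IsHeight D h) (hm : Monotone h) (i : Fin n) :
    h i + ((repeats h).filter (· < i.val)).card = i := by
  obtain ⟨i, hi⟩ := i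
  simp only
  induction i with
  | zero =>
    have : h ⟨0, hi⟩ = 0 := by
      by_contra hne
      obtain ⟨l, hl⟩ := Nat.exists_eq_succ_of_ne_zero hne
      obtain ⟨u, hu, -⟩ := hh.exists_pred hl
      have := hh.fin_lt hm hu
      simp [Fin.lt_def] at this
    simp [this]
  | succ i ih =>
    have ih := ih (by omega)
    have hle : h ⟨i, by omega⟩ ≤ h ⟨i + 1, hi⟩ := hm (by simp)
    have hstep : h ⟨i + 1, hi⟩ ≤ h ⟨i, by omega⟩ + 1 := by
      rcases hl : h ⟨i + 1, hi⟩ with _ | l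
      · omega
      · obtain ⟨u, hu, hul⟩ := hh.exists_pred hl
        have h1 := hh.fin_lt hm hu
        have : h u ≤ h ⟨i, by omega⟩ := hm (by
          rw [Fin.lt_def] at h1
          rw [Fin.le_def]
          simp only at *
          omega)
        omega
    have hcard : ((repeats h).filter (· < i + 1)).card =
        ((repeats h).filter (· < i)).card + if i ∈ repeats h then 1 else 0 := by
      have : (repeats h).filter (· < i + 1) =
          (repeats h).filter (· < i) ∪ (repeats h).filter (· = i) := by
        rw [← Finset.filter_or]
        refine Finset.filter_congr fun x _ => ?_
        omega
      rw [this, Finset.card_union_of_disjoint, Finset.filter_eq']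
      · split_ifs <;> simp
      · rw [Finset.disjoint_filter]
        intro x _ h1 h2
        omega
    rw [hcard]
    split_ifs with hr
    · obtain ⟨_, hr⟩ := mem_repeats.1 hr
      omega
    · have : h ⟨i + 1, hi⟩ ≠ h ⟨i, by omega⟩ := fun e => hr (mem_repeats.2 ⟨hi, e⟩)
      omega

/-- The missing pairs of consecutive vertices on the same level. -/
noncomputable def missingRepeats (D : Digraph (Fin n)) (h : Fin n → ℕ) : Finset (Fin n × Fin n) :=
  (missing D).filter fun x => h x.1 = h x.2 ∧ x.2.val = x.1.val + 1

theorem IsHeight.card_repeats_le (hh : IsHeight D h) (hm : Monotone h) :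
    (repeats h).card ≤ (missingRepeats D h).card := by
  classical
  have : repeats h ⊆ (missingRepeats D h).image fun x => x.1.val := by
    intro r hr
    obtain ⟨hr, e⟩ := mem_repeats.1 hr
    refine Finset.mem_image.2 ⟨(⟨r, by omega⟩, ⟨r + 1, hr⟩), ?_, rfl⟩
    refine Finset.mem_filter.2 ⟨(hh.mem_missing hm).2 ⟨by simp [Fin.lt_def], fun h1 => ?_⟩,
      e.symm, rfl⟩
    have := hh.lt h1
    omega
  exact (Finset.card_le_card this).trans Finset.card_image_le

theorem exists_sorted_three {R : Finset ℕ} (hR : R.card = 3) :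
    ∃ a b c, a < b ∧ b < c ∧ R = {a, b, c} := by
  let e := R.orderEmbOfFin hR
  refine ⟨e 0, e 1, e 2, e.strictMono (by decide), e.strictMono (by decide), ?_⟩
  ext x
  have : x ∈ R ↔ ∃ i, e i = x := by
    rw [← Finset.mem_coe, ← Finset.range_orderEmbOfFin R hR, Set.mem_range]
  rw [this]
  simp [Fin.exists_fin_succ, eq_comm]

theorem exists_sorted_four {R : Finset ℕ} (hR : R.card = 4) :
    ∃ a b c d, a < b ∧ b < c ∧ c < d ∧ R = {a, b, c, d} := by
  let e := R.orderEmbOfFin hR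
  refine ⟨e 0, e 1, e 2, e 3, e.strictMono (by decide), e.strictMono (by decide),
    e.strictMono (by decide), ?_⟩
  ext x
  have : x ∈ R ↔ ∃ i, e i = x := by
    rw [← Finset.mem_coe, ← Finset.range_orderEmbOfFin R hR, Set.mem_range]
  rw [this]
  simp [Fin.exists_fin_succ, eq_comm]

/-- A walk `w` to the last vertex has length `l = n - 1 - R ≥ k + 1`, where `R` is the number of
repeats. Present skips are at least `k` apart, so at most two of the `l - 1` possible ones occur. -/
theorem IsHeight.five_le_missing (hh : IsHeight D h) (hm : Monotone h) (hD : WalkFree k D)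
    (hn : n = k + 4) (hk : 5 ≤ k) (hR : (repeats h).card ≤ 2) : 5 ≤ (missing D).card := by
  classical
  have htop := hh.add_repeats hm ⟨n - 1, by omega⟩
  have hle := Finset.card_filter_le (repeats h) (· < n - 1)
  have hcr := hh.card_repeats_le hm
  simp only at htop
  obtain ⟨w, hwh, hw, -⟩ := hh.exists_walk ⟨n - 1, by omega⟩
  generalize h ⟨n - 1, by omega⟩ = l at *
  let G := (Finset.range (l - 1)).filter fun t => D.Adj (w t) (w (t + 2))
  let B := (Finset.range (l - 1)).filter fun t => ¬ D.Adj (w t) (w (t + 2))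
  have hGB : G.card + B.card = l - 1 := by
    rw [Finset.card_filter_add_card_filter_not, Finset.card_range]
  have hgap : ∀ s ∈ G, ∀ t ∈ G, s < t → s + k ≤ t := by
    intro s hs t ht hst
    by_contra hlt
    simp only [G, Finset.mem_filter, Finset.mem_range] at hs ht
    exact hD.not_adj_skip (h := h) (l := l) (by omega) hw hwh hst (by omega) (by omega) hs.2 ht.2
  have hG : G.card ≤ 2 := by
    by_contra hlt
    obtain ⟨a, ha, b, hb, c, hc, hab, hac, hbc⟩ := Finset.two_lt_card.1 (not_le.1 hlt)
    have h1 := hgap a ha b hb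
    have h2 := hgap b hb a ha
    have h3 := hgap a ha c hc
    have h4 := hgap c hc a ha
    have h5 := hgap b hb c hc
    have h6 := hgap c hc b hb
    simp only [G, Finset.mem_filter, Finset.mem_range] at ha hb hc
    omega
  have hB : B ⊆ ((missing D).filter fun x => h x.2 = h x.1 + 2).image fun x => h x.1 := by
    intro t ht
    simp only [B, Finset.mem_filter, Finset.mem_range] at ht
    have e1 := hwh t (by omega)
    have e2 := hwh (t + 2) (by omega)
    refine Finset.mem_image.2 ⟨(w t, w (t + 2)), Finset.mem_filter.2
      ⟨(hh.mem_missing hm).2 ⟨?_, ht.2⟩, by simp only; omega⟩, e1⟩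
    by_contra hlt
    have := hm (not_lt.1 hlt)
    omega
  have hBc := (Finset.card_le_card hB).trans Finset.card_image_le
  have hdisj : Disjoint (missingRepeats D h) ((missing D).filter fun x => h x.2 = h x.1 + 2) := by
    unfold missingRepeats
    rw [Finset.disjoint_filter]
    intro x _ h1 h2
    omega
  have hsub : missingRepeats D h ∪ ((missing D).filter fun x => h x.2 = h x.1 + 2) ⊆ missing D :=
    Finset.union_subset (Finset.filter_subset _ _) (Finset.filter_subset _ _)
  have := Finset.card_le_card hsub
  rw [Finset.card_union_of_disjoint hdisj] at this
  -- Absent skips and repeats together number at least `(l - 1 - 2) + (n - 1 - l) = n - 4 = k ≥ 5`.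
  omega

/-- Three vertices share a level, and its outer pair is missing without being a pair of neighbours
in the order. -/
theorem IsHeight.exists_missing_of_consecutive (hh : IsHeight D h) (hm : Monotone h) {r : ℕ}
    (h1 : r ∈ repeats h) (h2 : r + 1 ∈ repeats h) :
    ∃ x ∈ missing D \ missingRepeats D h, x.1.val = r ∧ h x.1 = h x.2 := by
  obtain ⟨hr, e1⟩ := mem_repeats.1 h1
  obtain ⟨hr', e2⟩ := mem_repeats.1 h2
  refine ⟨(⟨r, by omega⟩, ⟨r + 2, hr'⟩), Finset.mem_sdiff.2 ⟨(hh.mem_missing hm).2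
    ⟨by simp [Fin.lt_def], fun h3 => ?_⟩, fun h3 => ?_⟩, rfl, ?_⟩
  · exact absurd (e2.trans e1) (hh.lt h3).ne'
  · have := (Finset.mem_filter.1 h3).2.2
    simp at this
  · exact (e2.trans e1).symm

theorem IsHeight.mem_missing_sdiff (hh : IsHeight D h) (hm : Monotone h) {i j : Fin n}
    (hlt : h i < h j) (hij : ¬ D.Adj i j) : (i, j) ∈ missing D \ missingRepeats D h := by
  refine Finset.mem_sdiff.2 ⟨(hh.mem_missing hm).2 ⟨?_, hij⟩, fun h3 => ?_⟩
  · by_contra hle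
    have := hm (not_lt.1 hle)
    omega
  · have := (Finset.mem_filter.1 h3).2.1
    simp only at this
    omega

theorem card_missing_sdiff_add (D : Digraph (Fin n)) (h : Fin n → ℕ) :
    (missing D \ missingRepeats D h).card + (missingRepeats D h).card = (missing D).card :=
  Finset.card_sdiff_add_card_eq_card (Finset.filter_subset _ _)

/-- The level of a vertex of the digraph with adjacency matrix `F₄ n k`. -/
def level₄ (n : ℕ) (k : Fin 4 → ℕ) (i : Fin n) : ℕ :=
  if hi : i.val < n - 4 then i.val else k ⟨i.val - (n - 4), by omega⟩

/-- Vertex `n - 4 + t` is a twin of vertex `k t` of the transitive tournament on the first `n - 4`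
vertices; strict monotonicity of `k` orders the twins among themselves. -/
theorem F₄_apply {k : Fin 4 → ℕ} (hk : StrictMono k) (i j : Fin n) :
    F₄ n k i j = if level₄ n k i < level₄ n k j then 1 else 0 := by
  unfold F₄ level₄
  simp only [Matrix.of_apply]
  split_ifs with h1 h2 h3 h3 h3 h3 h2 h3 h3 h3 h3 <;> first | rfl | skip
  all_goals exfalso
  all_goals first
    | omega
    | (rw [hk.lt_iff_lt, Fin.lt_def] at *; simp only at *; omega)

theorem level₄_of_eq {k : Fin 4 → ℕ} {i : Fin n} (t : Fin 4) (hi : i.val = n - 4 + t.val) :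
    level₄ n k i = k t := by
  unfold level₄
  rw [dif_neg (by omega)]
  congr 1
  exact Fin.ext (by simp only; omega)

/-- The first vertex of each doubled level moves to the end, and every other vertex is numbered by
its height. The doubled levels are `a`, `b - 1`, `c - 2`, `d - 3`. -/
theorem permSimilar_F₄ {a b c d : ℕ} (hab : a + 1 < b) (hbc : b + 1 < c) (hcd : c + 1 < d)
    (hdn : d + 1 < n) (hform : ∀ i, i.val ≤ a ∧ h i = i ∨ a < i.val ∧ i.val ≤ b ∧ h i + 1 = i ∨
      b < i.val ∧ i.val ≤ c ∧ h i + 2 = i ∨ c < i.val ∧ i.val ≤ d ∧ h i + 3 = i ∨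
      d < i.val ∧ h i + 4 = i)
    (hadj : ∀ i j, D.Adj i j ↔ h i < h j) :
    PermSimilar (adjMatrix D) (F₄ n ![a, b - 1, c - 2, d - 3]) := by
  have hk : StrictMono ![a, b - 1, c - 2, d - 3] := by
    rw [Fin.strictMono_iff_lt_succ]
    intro i
    fin_cases i <;> simp <;> omega
  have hlt : ∀ i, (if i.val = a then n - 4 else if i.val = b then n - 3 else if i.val = c then n - 2
      else if i.val = d then n - 1 else h i) < n := by
    intro i
    have := hform i
    have := i.2
    split_ifs <;> omega
  have hlevel : ∀ i, level₄ n ![a, b - 1, c - 2, d - 3] ⟨_, hlt i⟩ = h i := by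
    intro i
    have := hform i
    have hi := i.2
    by_cases h1 : i.val = a
    · rw [level₄_of_eq 0 (by simp only [Fin.val_zero]; split_ifs; omega)]
      simp only [Matrix.cons_val]
      omega
    by_cases h2 : i.val = b
    · rw [level₄_of_eq 1 (by simp only [Fin.val_one]; split_ifs; omega)]
      simp only [Matrix.cons_val]
      omega
    by_cases h3 : i.val = c
    · rw [level₄_of_eq 2 (by simp only [Fin.val_two]; split_ifs; omega)]
      simp only [Matrix.cons_val]
      omega
    by_cases h4 : i.val = d
    · rw [level₄_of_eq 3 (by simp only [Fin.coe_ofNat_eq_mod]; split_ifs; omega)]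
      simp only [Matrix.cons_val]
      omega
    unfold level₄
    simp only [h1, h2, h3, h4, if_false]
    rw [dif_pos (by omega)]
  refine permSimilar_of_injective (fun i => ⟨_, hlt i⟩) ?_ fun i j => ?_
  · intro i j hij
    have h1 := hform i
    have h2 := hform j
    simp only [Fin.mk.injEq] at hij
    rw [Fin.ext_iff]
    clear hadj hlevel hlt hform
    split_ifs at hij <;> omega
  · rw [F₄_apply hk, hlevel, hlevel]
    simp only [arc, hadj]

theorem permSimilar_F₁ (hn : 9 ≤ n) (hform : ∀ i, i.val ≤ 0 ∧ h i = i ∨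
      0 < i.val ∧ i.val ≤ 1 ∧ h i + 1 = i ∨ 1 < i.val ∧ i.val ≤ n - 2 ∧ h i + 2 = i ∨
      n - 2 < i.val ∧ h i + 3 = i)
    (hadj : ∀ i j, D.Adj i j ↔ h i < h j) : PermSimilar (adjMatrix D) (F₁ n) := by
  refine permSimilar_of_injective id Function.injective_id fun i j => ?_
  simp only [id, F₁, Matrix.of_apply, arc, hadj, Fin.lt_def]
  have hi := hform i
  have hj := hform j
  have := i.2
  have := j.2
  clear hform hadj
  split_ifs <;> omega

theorem permSimilar_F₂ (hn : 9 ≤ n) (hform : ∀ i, i.val ≤ 0 ∧ h i = i ∨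
      0 < i.val ∧ i.val ≤ n - 3 ∧ h i + 1 = i ∨ n - 3 < i.val ∧ i.val ≤ n - 2 ∧ h i + 2 = i ∨
      n - 2 < i.val ∧ h i + 3 = i)
    (hadj : ∀ i j, D.Adj i j ↔ h i < h j) : PermSimilar (adjMatrix D) (F₂ n) := by
  refine permSimilar_of_injective id Function.injective_id fun i j => ?_
  simp only [id, F₂, Matrix.of_apply, arc, hadj, Fin.lt_def]
  have hi := hform i
  have hj := hform j
  have := i.2
  have := j.2
  clear hform hadj
  split_ifs <;> omega

/-- Vertex `y`, one of the two on level `b - 1`, moves to the end and the later ones shift down by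
one; `m = b - 2` since `F₃ n m` puts its last vertex on level `m + 1`. -/
theorem permSimilar_F₃ {b : ℕ} (hb : 2 ≤ b) (hbn : b + 4 < n) (hform : ∀ i, i.val ≤ 0 ∧ h i = i ∨
      0 < i.val ∧ i.val ≤ b ∧ h i + 1 = i ∨ b < i.val ∧ i.val ≤ n - 2 ∧ h i + 2 = i ∨
      n - 2 < i.val ∧ h i + 3 = i) {y z : Fin n} (hy : y.val = b ∨ y.val = b + 1)
    (hz : z.val = b + 2)
    (hadj : ∀ i j, D.Adj i j ↔ h i < h j ∧ ¬ (i = y ∧ j = z)) :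
    PermSimilar (adjMatrix D) (F₃ n (b - 2)) := by
  have hlt : ∀ i : Fin n, (if i.val = y.val then n - 1 else if i.val < y.val then i.val
      else i.val - 1) < n := by
    intro i
    have := i.2
    split_ifs <;> omega
  obtain ⟨f, hf⟩ : ∃ f : Fin n → Fin n, ∀ i, i.val = y.val ∧ (f i).val = n - 1 ∨
      i.val < y.val ∧ (f i).val = i.val ∨ y.val < i.val ∧ (f i).val + 1 = i.val := by
    refine ⟨fun i => ⟨_, hlt i⟩, fun i => ?_⟩
    simp only
    split_ifs <;> omega
  refine permSimilar_of_injective f (fun i j hij => ?_) fun i j => ?_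
  · have hi := hf i
    have hj := hf j
    have := i.2
    have := j.2
    rw [Fin.ext_iff] at hij ⊢
    omega
  · simp only [F₃, Matrix.of_apply, arc, hadj, Fin.lt_def, Fin.ext_iff]
    have hi := hform i
    have hj := hform j
    have hi' := hf i
    have hj' := hf j
    have hin := i.2
    have hjn := j.2
    clear hform hadj hlt hf
    split_ifs <;> omega

theorem adj_iff_of_missing_sdiff (hh : IsHeight D h) (hm : Monotone h)
    (hx : ∀ x ∈ missing D \ missingRepeats D h, h x.1 = h x.2) (i j : Fin n) :
    D.Adj i j ↔ h i < h j := by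
  refine ⟨hh.lt, fun hlt => ?_⟩
  by_contra hij
  have := hx _ (hh.mem_missing_sdiff hm hlt hij)
  simp only at this
  omega

/-- The four repeats exhaust the missing pairs. So no level has three vertices, and all pairs on
different levels are joined. -/
theorem IsHeight.extremal_of_four_repeats (hh : IsHeight D h) (hm : Monotone h)
    (hc : (missing D).card ≤ 4) (hR : (repeats h).card = 4) :
    ∃ k : Fin 4 → ℕ, StrictMono k ∧ k 3 ≤ n - 5 ∧ PermSimilar (adjMatrix D) (F₄ n k) := by
  have h1 := card_missing_sdiff_add D h
  have h2 := hh.card_repeats_le hm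
  have hE : missing D \ missingRepeats D h = ∅ := Finset.card_eq_zero.1 (by omega)
  have hnc : ∀ r, r ∈ repeats h → r + 1 ∉ repeats h := by
    intro r hr hr'
    obtain ⟨x, hx, -⟩ := hh.exists_missing_of_consecutive hm hr hr'
    simp [hE] at hx
  have hadj := adj_iff_of_missing_sdiff hh hm (by simp [hE])
  obtain ⟨a, b, c, d, hab, hbc, hcd, hRe⟩ := exists_sorted_four hR
  have hab' : a + 1 < b := by
    have := hnc a (by simp [hRe])
    have : a + 1 ≠ b := fun e => this (by simp [hRe, e])
    omega
  have hbc' : b + 1 < c := by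
    have := hnc b (by simp [hRe])
    have : b + 1 ≠ c := fun e => this (by simp [hRe, e])
    omega
  have hcd' : c + 1 < d := by
    have := hnc c (by simp [hRe])
    have : c + 1 ≠ d := fun e => this (by simp [hRe, e])
    omega
  obtain ⟨hdn, -⟩ := mem_repeats.1 (show d ∈ repeats h by simp [hRe])
  have hform := hh.add_repeats hm
  refine ⟨_, ?_, ?_, permSimilar_F₄ hab' hbc' hcd' hdn ?_ hadj⟩
  · rw [Fin.strictMono_iff_lt_succ]
    intro i
    fin_cases i <;> simp <;> omega
  · simp only [Matrix.cons_val]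
    omega
  · intro i
    have := hform i
    rw [hRe, Finset.card_filter, Finset.sum_insert (by simp; omega),
      Finset.sum_insert (by simp; omega), Finset.sum_insert (by simp; omega),
      Finset.sum_singleton] at this
    split_ifs at this <;> omega

/-- The top height is `k`, and at most one missing pair is not a repeat. A level with three vertices
uses up that pair and gives `F₁` or `F₂`. Otherwise three levels are doubled; only the bottom, the
top and one blocked level between them are possible, which gives `F₃`. -/
theorem IsHeight.extremal_of_three_repeats (hh : IsHeight D h) (hm : Monotone h)
    (hD : WalkFree k D) (hn : n = k + 4) (hk : 5 ≤ k)
    (hc : (missing D).card ≤ 4) (hR : (repeats h).card = 3) :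
    4 ≤ (missing D).card ∧ (PermSimilar (adjMatrix D) (F₁ n) ∨ PermSimilar (adjMatrix D) (F₂ n) ∨
      ∃ m ≤ n - 7, PermSimilar (adjMatrix D) (F₃ n m)) := by
  have h1 := card_missing_sdiff_add D h
  have h2 := hh.card_repeats_le hm
  have hE : (missing D \ missingRepeats D h).card ≤ 1 := by omega
  have hfour : ∀ x ∈ missing D \ missingRepeats D h, 4 ≤ (missing D).card := by
    intro x hx
    have := Finset.card_pos.2 ⟨x, hx⟩
    omega
  obtain ⟨a, b, c, hab, hbc, hRe⟩ := exists_sorted_three hR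
  have haR : a ∈ repeats h := by simp [hRe]
  have hbR : b ∈ repeats h := by simp [hRe]
  have hcR : c ∈ repeats h := by simp [hRe]
  obtain ⟨han, hae⟩ := mem_repeats.1 haR
  obtain ⟨hbn, hbe⟩ := mem_repeats.1 hbR
  obtain ⟨hcn, hce⟩ := mem_repeats.1 hcR
  have hform : ∀ i, i.val ≤ a ∧ h i = i ∨ a < i.val ∧ i.val ≤ b ∧ h i + 1 = i ∨
      b < i.val ∧ i.val ≤ c ∧ h i + 2 = i ∨ c < i.val ∧ h i + 3 = i := by
    intro i
    have := hh.add_repeats hm i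
    rw [hRe, Finset.card_filter, Finset.sum_insert (by simp; omega),
      Finset.sum_insert (by simp; omega), Finset.sum_singleton] at this
    split_ifs at this <;> omega
  have hv : h ⟨n - 1, by omega⟩ = k := by
    have := hform ⟨n - 1, by omega⟩
    simp only at this
    omega
  have ha := hform ⟨a, by omega⟩
  have hb := hform ⟨b, by omega⟩
  have hcc := hform ⟨c, by omega⟩
  simp only at ha hb hcc
  have full : ∀ (r : ℕ) (hr : r + 1 < n), h ⟨r + 1, hr⟩ = h ⟨r, by omega⟩ →
      (∀ i j, D.Adj i j ↔ h i < h j) → h ⟨r, by omega⟩ = 0 ∨ h ⟨r, by omega⟩ = k := by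
    intro r hr hre hadj
    by_contra! hne
    have hle : h ⟨r, by omega⟩ ≤ h ⟨n - 1, by omega⟩ :=
      hm (by rw [Fin.le_def]; simp only; omega)
    obtain ⟨p, hp⟩ := Nat.exists_eq_succ_of_ne_zero hne.1
    -- There is no exceptional pair here, so `y = z` is a dummy; the conclusion would put it on two
    -- levels at once.
    have := hh.eq_of_internal hD hv (y := ⟨r, by omega⟩) (z := ⟨r, by omega⟩)
      (fun i j hij _ => (hadj i j).2 hij) (x := ⟨r, by omega⟩) (x' := ⟨r + 1, hr⟩)
      (by simp) hp (by rw [hre, hp]) (by omega)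
    omega
  have hnt : ¬ (b = a + 1 ∧ c = b + 1) := by
    rintro ⟨hab1, hbc1⟩
    obtain ⟨x, hx, hxa, -⟩ := hh.exists_missing_of_consecutive hm haR (hab1 ▸ hbR)
    obtain ⟨x', hx', hxb, -⟩ := hh.exists_missing_of_consecutive hm hbR (hbc1 ▸ hcR)
    rw [Finset.card_le_one.1 hE x hx x' hx'] at hxa
    omega
  by_cases hab1 : b = a + 1
  · obtain ⟨x, hx, hxa, hxh⟩ := hh.exists_missing_of_consecutive hm haR (hab1 ▸ hbR)
    have hadj := adj_iff_of_missing_sdiff hh hm fun x' hx' => by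
      rw [Finset.card_le_one.1 hE x' hx' x hx, hxh]
    have f1 := full a han hae hadj
    have f2 := full c hcn hce hadj
    refine ⟨hfour x hx, .inl (permSimilar_F₁ (by omega) ?_ hadj)⟩
    obtain rfl : a = 0 := by omega
    obtain rfl : b = 1 := by omega
    obtain rfl : c = n - 2 := by omega
    exact hform
  by_cases hbc1 : c = b + 1
  · obtain ⟨x, hx, hxa, hxh⟩ := hh.exists_missing_of_consecutive hm hbR (hbc1 ▸ hcR)
    have hadj := adj_iff_of_missing_sdiff hh hm fun x' hx' => by
      rw [Finset.card_le_one.1 hE x' hx' x hx, hxh]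
    have f1 := full a han hae hadj
    have f2 := full c hcn hce hadj
    refine ⟨hfour x hx, .inr (.inl (permSimilar_F₂ (by omega) ?_ hadj))⟩
    obtain rfl : a = 0 := by omega
    obtain rfl : b = n - 3 := by omega
    obtain rfl : c = n - 2 := by omega
    exact hform
  have : Nonempty (Fin n × Fin n) := ⟨(⟨0, by omega⟩, ⟨0, by omega⟩)⟩
  -- A priori `(y, z)` may be an arbitrary pair, with nothing extra missing; applying `internal` at
  -- `b` shows that it is missing.
  obtain ⟨⟨y, z⟩, hyz⟩ := Finset.card_le_one_iff_subset_singleton.1 hE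
  have hadj : ∀ i j, h i < h j → ¬ (i = y ∧ j = z) → D.Adj i j := by
    intro i j hlt hne
    by_contra hij
    have := hyz (hh.mem_missing_sdiff hm hlt hij)
    simp only [Finset.mem_singleton, Prod.mk.injEq] at this
    exact hne this
  have internal : ∀ (r : ℕ) (hr : r + 1 < n), h ⟨r + 1, hr⟩ = h ⟨r, by omega⟩ →
      0 < h ⟨r, by omega⟩ → h ⟨r, by omega⟩ < k →
      h y = h ⟨r, by omega⟩ ∧ h z = h ⟨r, by omega⟩ + 1 ∧ (y.val = r ∨ y.val = r + 1) ∧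
      ¬ D.Adj y z ∧ (h ⟨r, by omega⟩ + 1 = k → ∀ z', h z' = k → z' = z) := by
    intro r hr hre h0 hlt
    obtain ⟨p, hp⟩ := Nat.exists_eq_succ_of_ne_zero h0.ne'
    obtain ⟨a1, a2, a3, a4, a5⟩ := hh.eq_of_internal hD hv hadj (x := ⟨r, by omega⟩)
      (x' := ⟨r + 1, hr⟩) (by simp) hp (by rw [hre, hp]) (by omega)
    refine ⟨by omega, by omega, ?_, a4, fun e => a5 (by omega)⟩
    simpa only [Fin.ext_iff] using a3
  obtain ⟨b1, b2, b3, b4, b5⟩ := internal b hbn hbe (by omega) (by omega)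
  have ha0 : a = 0 := by
    by_contra hne
    have := internal a han hae (by omega) (by omega)
    omega
  have hck : h ⟨c, by omega⟩ = k := by
    by_contra hne
    have := internal c hcn hce (by omega) (by omega)
    omega
  -- If the doubled level were just below the top, `z` would be the only top vertex, but `c` and `c
  -- + 1` are both on top.
  have hbk : h ⟨b, by omega⟩ + 1 ≠ k := by
    intro e
    have e1 := b5 e ⟨c, by omega⟩ hck
    have e2 := b5 e ⟨c + 1, hcn⟩ (hce.trans hck)
    have := e1.trans e2.symm
    simp at this
  have hz := hform z
  refine ⟨hfour (y, z) (hh.mem_missing_sdiff hm (by omega) b4), .inr (.inr ⟨b - 2, by omega,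
    permSimilar_F₃ (y := y) (z := z) (by omega) (by omega) ?_ b3 (by omega) fun i j => ⟨fun hij =>
      ⟨hh.lt hij, ?_⟩, fun hij => hadj i j hij.1 hij.2⟩⟩)⟩
  · obtain rfl : c = n - 2 := by omega
    subst ha0
    exact hform
  · rintro ⟨rfl, rfl⟩
    exact b4 hij

end Sorted

/-! ### The upper bound and the case of equality. -/

section Upper

variable {n : ℕ} {D : Digraph (Fin n)}

/-- `A` is permutation similar to one of the matrices `F₁ n`, `F₂ n`, `F₃ n m`, `F₄ n k`. -/
def IsExtremalMatrix (A : Matrix (Fin n) (Fin n) ℕ) : Prop :=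
  PermSimilar A (F₁ n) ∨ PermSimilar A (F₂ n) ∨ (∃ m : ℕ, m ≤ n - 7 ∧ PermSimilar A (F₃ n m)) ∨
    ∃ k : Fin 4 → ℕ, StrictMono k ∧ k 3 ≤ n - 5 ∧ PermSimilar A (F₄ n k)

theorem IsExtremalMatrix.of_relabel {σ : Equiv.Perm (Fin n)}
    (h : IsExtremalMatrix (adjMatrix (WalkTuran.relabel D σ))) : IsExtremalMatrix (adjMatrix D) := by
  obtain h | h | ⟨m, hm, h⟩ | ⟨k, hk, hk3, h⟩ := h
  · exact .inl h.of_relabel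
  · exact .inr (.inl h.of_relabel)
  · exact .inr (.inr (.inl ⟨m, hm, h.of_relabel⟩))
  · exact .inr (.inr (.inr ⟨k, hk, hk3, h.of_relabel⟩))

theorem IsHeight.extremal {h : Fin n → ℕ} (hh : IsHeight D h) (hm : Monotone h) (hn : 9 ≤ n)
    (hD : WalkFree (n - 4) D) (hc : (missing D).card ≤ 4) :
    4 ≤ (missing D).card ∧ IsExtremalMatrix (adjMatrix D) := by
  have h1 := card_missing_sdiff_add D h
  have h2 := hh.card_repeats_le hm
  obtain hR | hR | hR : (repeats h).card ≤ 2 ∨ (repeats h).card = 3 ∨ (repeats h).card = 4 := by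
    omega
  · have := hh.five_le_missing hm hD (by omega) (by omega) hR
    omega
  · obtain ⟨h3, h | h | ⟨m, hm, h⟩⟩ :=
      hh.extremal_of_three_repeats hm hD (by omega) (by omega) hc hR
    · exact ⟨h3, .inl h⟩
    · exact ⟨h3, .inr (.inl h)⟩
    · exact ⟨h3, .inr (.inr (.inl ⟨m, hm, h⟩))⟩
  · exact ⟨by omega, .inr (.inr (.inr (hh.extremal_of_four_repeats hm hc hR)))⟩

theorem WalkFree.size_le (hn : 9 ≤ n) (hD : WalkFree (n - 4) D) :
    2 * size D + 8 + n ≤ n * n ∧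
      (2 * size D + 8 + n = n * n → IsExtremalMatrix (adjMatrix D)) := by
  by_cases hcl : ∃ g, 0 < g ∧ HasClosedWalk D Finset.univ g
  · have := arcsIn_bound_of_closedWalk hD (by omega) Finset.univ hcl
    rw [← size_eq_arcsIn, Finset.card_univ, Fintype.card_fin] at this
    omega
  · push Not at hcl
    obtain ⟨h, hh⟩ := exists_isHeight (wellFounded_adj_of_no_closedWalk hcl)
    have hh' : IsHeight (WalkTuran.relabel D (Tuple.sort h)) (h ∘ Tuple.sort h) := by
      refine ⟨fun huv => hh.lt huv, fun {v l} hl => ?_⟩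
      obtain ⟨u, huv, hu⟩ := hh.exists_pred hl
      refine ⟨(Tuple.sort h).symm u, ?_, ?_⟩
      · change D.Adj _ _
        rwa [Equiv.apply_symm_apply]
      · simpa using hu
    have hm := Tuple.monotone_sort h
    have hsize := two_mul_size_add_missing (D := WalkTuran.relabel D (Tuple.sort h)) fun i j h1 h2 =>
      lt_asymm (hh'.lt h1) (hh'.lt h2)
    rw [size_relabel] at hsize
    have key := fun hc => hh'.extremal hm hn (hD.relabel _) hc
    by_cases hc : (missing (WalkTuran.relabel D (Tuple.sort h))).card ≤ 4
    · have := (key hc).1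
      exact ⟨by omega, fun _ => (key hc).2.of_relabel⟩
    · omega

end Upper

/-! ### The four matrices attain the bound. -/

section Lower

variable {n k : ℕ} {D : Digraph (Fin n)}

/-- Levels rise strictly over `k` steps within `0, …, k`, so counting from the start bounds the
level below by `t`, and counting from the end bounds it above. -/
theorem level_eq_of_isWalk {V : Type*} {D : Digraph V} {H : V → ℕ}
    (hlt : ∀ u v, D.Adj u v → H u < H v) (hle : ∀ v, H v ≤ k) {p : Fin (k + 1) → V}
    (hp : IsWalk D k p) (t : Fin (k + 1)) : H (p t) = t := by
  have h1 : ∀ t : Fin (k + 1), t.val ≤ H (p t) := by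
    intro t
    induction t using Fin.induction with
    | zero => simp
    | succ i ih =>
      have := hlt _ _ (hp i)
      simp only [Fin.val_castSucc, Fin.val_succ] at *
      omega
  have h2 : ∀ t : Fin (k + 1), H (p t) ≤ t := by
    intro t
    induction t using Fin.reverseInduction with
    | last => simpa using hle _
    | cast i ih =>
      have := hlt _ _ (hp i)
      simp only [Fin.val_castSucc, Fin.val_succ] at *
      omega
  exact le_antisymm (h2 t) (h1 t)

/-- Both walks are on level `t` at time `t`, and an inner vertex of a walk must have an arc to the
next level; `hint` leaves one such vertex per inner level. -/
theorem walkFree_of_level {V : Type*} {D : Digraph V} {H : V → ℕ}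
    (hlt : ∀ u v, D.Adj u v → H u < H v) (hle : ∀ v, H v ≤ k)
    (hint : ∀ u u', H u = H u' → 0 < H u → H u < k → (∃ v, D.Adj u v ∧ H v = H u + 1) →
      (∃ v, D.Adj u' v ∧ H v = H u' + 1) → u = u') : WalkFree k D := by
  rintro ⟨p, q, hp, hq, h0, hk, hne⟩
  refine hne (funext fun t => ?_)
  have hp' := level_eq_of_isWalk hlt hle hp
  have hq' := level_eq_of_isWalk hlt hle hq
  induction t using Fin.lastCases with
  | last => exact hk
  | cast i =>
    rcases Nat.eq_zero_or_pos i.val with hi | hi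
    · have : i.castSucc = 0 := Fin.ext (by simpa using hi)
      rw [this, h0]
    · have e1 := hp' i.castSucc
      have e2 := hq' i.castSucc
      have e3 := hp' i.succ
      have e4 := hq' i.succ
      simp only [Fin.val_castSucc, Fin.val_succ] at e1 e2 e3 e4
      have := i.2
      exact hint _ _ (by omega) (by omega) (by omega) ⟨_, hp i, by omega⟩ ⟨_, hq i, by omega⟩

theorem extremal_F₁ (hn : 9 ≤ n) (hF : ∀ i j, D.Adj i j ↔ F₁ n i j = 1) :
    WalkFree (n - 4) D ∧ (∀ i j, D.Adj i j → ¬ D.Adj j i) ∧ (missing D).card ≤ 4 := by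
  let H : Fin n → ℕ := fun i => if i.val < 3 then 0 else if i.val < n - 2 then i.val - 2 else n - 4
  have hH : ∀ i, i.val < 3 ∧ H i = 0 ∨ 3 ≤ i.val ∧ i.val < n - 2 ∧ H i + 2 = i.val ∨
      n - 2 ≤ i.val ∧ H i = n - 4 := by
    intro i
    simp only [H]
    split_ifs <;> omega
  have hadj : ∀ i j, D.Adj i j ↔ H i < H j := by
    intro i j
    have hi := hH i
    have hj := hH j
    have := i.2
    have := j.2
    rw [hF]
    simp only [F₁, Matrix.of_apply, Fin.lt_def]
    split_ifs <;> simp only [false_iff, true_iff] <;> omega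
  clear_value H
  refine ⟨walkFree_of_level (H := H) (fun u v h => (hadj u v).1 h) ?_ ?_,
    fun i j h1 h2 => lt_asymm ((hadj i j).1 h1) ((hadj j i).1 h2), ?_⟩
  · intro i
    have := hH i
    omega
  · intro u u' he h0 hlt _ _
    have := hH u
    have := hH u'
    exact Fin.ext (by omega)
  · refine (Finset.card_le_card (t := {(⟨0, by omega⟩, ⟨1, by omega⟩), (⟨0, by omega⟩, ⟨2, by omega⟩),
      (⟨1, by omega⟩, ⟨2, by omega⟩), (⟨n - 2, by omega⟩, ⟨n - 1, by omega⟩)}) ?_).trans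
      Finset.card_le_four
    rintro ⟨i, j⟩ hij
    rw [mem_missing, hadj, hadj, Fin.lt_def] at hij
    simp only [Finset.mem_insert, Finset.mem_singleton, Prod.mk.injEq, Fin.ext_iff]
    have := hH i
    have := hH j
    have := j.2
    omega

theorem extremal_F₂ (hn : 9 ≤ n) (hF : ∀ i j, D.Adj i j ↔ F₂ n i j = 1) :
    WalkFree (n - 4) D ∧ (∀ i j, D.Adj i j → ¬ D.Adj j i) ∧ (missing D).card ≤ 4 := by
  let H : Fin n → ℕ := fun i => if i.val < 2 then 0 else if i.val < n - 3 then i.val - 1 else n - 4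
  have hH : ∀ i, i.val < 2 ∧ H i = 0 ∨ 2 ≤ i.val ∧ i.val < n - 3 ∧ H i + 1 = i.val ∨
      n - 3 ≤ i.val ∧ H i = n - 4 := by
    intro i
    simp only [H]
    split_ifs <;> omega
  have hadj : ∀ i j, D.Adj i j ↔ H i < H j := by
    intro i j
    have hi := hH i
    have hj := hH j
    have := i.2
    have := j.2
    rw [hF]
    simp only [F₂, Matrix.of_apply, Fin.lt_def]
    split_ifs <;> simp only [false_iff, true_iff] <;> omega
  clear_value H
  refine ⟨walkFree_of_level (H := H) (fun u v h => (hadj u v).1 h) ?_ ?_,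
    fun i j h1 h2 => lt_asymm ((hadj i j).1 h1) ((hadj j i).1 h2), ?_⟩
  · intro i
    have := hH i
    omega
  · intro u u' he h0 hlt _ _
    have := hH u
    have := hH u'
    exact Fin.ext (by omega)
  · refine (Finset.card_le_card (t := {(⟨0, by omega⟩, ⟨1, by omega⟩),
      (⟨n - 3, by omega⟩, ⟨n - 2, by omega⟩), (⟨n - 3, by omega⟩, ⟨n - 1, by omega⟩),
      (⟨n - 2, by omega⟩, ⟨n - 1, by omega⟩)}) ?_).trans Finset.card_le_four
    rintro ⟨i, j⟩ hij
    rw [mem_missing, hadj, hadj, Fin.lt_def] at hij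
    simp only [Finset.mem_insert, Finset.mem_singleton, Prod.mk.injEq, Fin.ext_iff]
    have := hH i
    have := hH j
    have := j.2
    omega

/-- The only inner level with two vertices is `m + 1`. Its vertex `n - 1` lacks the arc to `m + 3`,
the sole vertex on level `m + 2`, so no walk of length `n - 4` passes through it. -/
theorem extremal_F₃ (hn : 9 ≤ n) {m : ℕ} (hm : m ≤ n - 7)
    (hF : ∀ i j, D.Adj i j ↔ F₃ n m i j = 1) :
    WalkFree (n - 4) D ∧ (∀ i j, D.Adj i j → ¬ D.Adj j i) ∧ (missing D).card ≤ 4 := by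
  let H : Fin n → ℕ := fun i => if i.val < 2 then 0 else if i.val < n - 3 then i.val - 1
    else if i.val < n - 1 then n - 4 else m + 1
  have hH : ∀ i, i.val < 2 ∧ H i = 0 ∨ 2 ≤ i.val ∧ i.val < n - 3 ∧ H i + 1 = i.val ∨
      n - 3 ≤ i.val ∧ i.val < n - 1 ∧ H i = n - 4 ∨ i.val = n - 1 ∧ H i = m + 1 := by
    intro i
    have := i.2
    simp only [H]
    split_ifs <;> omega
  have hadj : ∀ i j, D.Adj i j ↔ H i < H j ∧ ¬ (i.val = n - 1 ∧ j.val = m + 3) := by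
    intro i j
    have hi := hH i
    have hj := hH j
    have := i.2
    have := j.2
    rw [hF]
    simp only [F₃, Matrix.of_apply, Fin.lt_def]
    clear_value H
    clear hH hF
    split_ifs <;> simp only [false_iff, true_iff] <;> omega
  clear_value H
  refine ⟨walkFree_of_level (H := H) (fun u v h => ((hadj u v).1 h).1) ?_ ?_,
    fun i j h1 h2 => lt_asymm ((hadj i j).1 h1).1 ((hadj j i).1 h2).1, ?_⟩
  · intro i
    have := hH i
    omega
  · rintro u u' he h0 hlt ⟨v, huv, hv⟩ ⟨v', huv', hv'⟩
    rw [hadj] at huv huv'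
    have h1 := hH u
    have h2 := hH u'
    have h3 := hH v
    have h4 := hH v'
    have := u.2
    have := u'.2
    exact Fin.ext (by omega)
  · refine (Finset.card_le_card (t := {(⟨0, by omega⟩, ⟨1, by omega⟩),
      (⟨n - 3, by omega⟩, ⟨n - 2, by omega⟩), (⟨m + 2, by omega⟩, ⟨n - 1, by omega⟩),
      (⟨m + 3, by omega⟩, ⟨n - 1, by omega⟩)}) ?_).trans Finset.card_le_four
    rintro ⟨i, j⟩ hij
    rw [mem_missing, hadj, hadj, Fin.lt_def] at hij
    simp only [Finset.mem_insert, Finset.mem_singleton, Prod.mk.injEq, Fin.ext_iff]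
    have := hH i
    have := hH j
    have := j.2
    omega

/-- Levels do not exceed `n - 5`, so there is no walk of length `n - 4` at all; the missing pairs
are the four pairs of twins. -/
theorem extremal_F₄ (hn : 9 ≤ n) {k : Fin 4 → ℕ} (hk : StrictMono k) (hk3 : k 3 ≤ n - 5)
    (hF : ∀ i j, D.Adj i j ↔ F₄ n k i j = 1) :
    WalkFree (n - 4) D ∧ (∀ i j, D.Adj i j → ¬ D.Adj j i) ∧ (missing D).card ≤ 4 := by
  have hadj : ∀ i j, D.Adj i j ↔ level₄ n k i < level₄ n k j := by
    intro i j
    rw [hF, F₄_apply hk]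
    simp
  have hkle : ∀ t, k t ≤ n - 5 := fun t => (hk.monotone (Fin.le_last t)).trans hk3
  have hlevel : ∀ i, level₄ n k i ≤ n - 5 := by
    intro i
    unfold level₄
    split_ifs
    · omega
    · exact hkle _
  refine ⟨?_, fun i j h1 h2 => lt_asymm ((hadj i j).1 h1) ((hadj j i).1 h2), ?_⟩
  · rintro ⟨p, -, hp, -⟩
    have h1 := level_eq_of_isWalk (fun u v h => (hadj u v).1 h)
      (fun v => (hlevel v).trans (by omega)) hp (Fin.last _)
    have h2 := hlevel (p (Fin.last _))
    rw [Fin.val_last] at h1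
    omega
  · have : missing D ⊆ Finset.univ.image fun t : Fin 4 =>
        ((⟨k t, by have := hkle t; omega⟩ : Fin n), (⟨n - 4 + t.val, by omega⟩ : Fin n)) := by
      rintro ⟨i, j⟩ hij
      rw [mem_missing, hadj, hadj, Fin.lt_def] at hij
      have hlev : level₄ n k i = level₄ n k j := by omega
      have hin : ∀ i : Fin n, i.val < n - 4 ∧ level₄ n k i = i.val ∨
          ∃ t : Fin 4, i.val = n - 4 + t.val ∧ level₄ n k i = k t := by
        intro i
        by_cases hi : i.val < n - 4
        · exact .inl ⟨hi, dif_pos hi⟩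
        · exact .inr ⟨⟨i.val - (n - 4), by omega⟩, by simp only; omega, dif_neg hi⟩
      obtain ⟨hj, hje⟩ | ⟨t, hj, hje⟩ := hin j
      · obtain ⟨hi, hie⟩ | ⟨s, hi, hie⟩ := hin i <;> omega
      · refine Finset.mem_image.2 ⟨t, Finset.mem_univ _, ?_⟩
        obtain ⟨hi, hie⟩ | ⟨s, hi, hie⟩ := hin i
        · simp only [Prod.mk.injEq, Fin.ext_iff]
          omega
        · have : s = t := hk.injective (by omega)
          subst this
          omega
    exact (Finset.card_le_card this).trans Finset.card_image_le

theorem IsExtremalMatrix.walkFree_and_size (hn : 9 ≤ n) (h : IsExtremalMatrix (adjMatrix D)) :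
    WalkFree (n - 4) D ∧ n * n ≤ 2 * size D + 8 + n := by
  have key : ∀ B : Matrix (Fin n) (Fin n) ℕ, PermSimilar (adjMatrix D) B →
      (∀ D' : Digraph (Fin n), (∀ i j, D'.Adj i j ↔ B i j = 1) →
        WalkFree (n - 4) D' ∧ (∀ i j, D'.Adj i j → ¬ D'.Adj j i) ∧ (missing D').card ≤ 4) →
      WalkFree (n - 4) D ∧ n * n ≤ 2 * size D + 8 + n := by
    intro B hB hall
    obtain ⟨σ, hσ⟩ := permSimilar_iff.1 hB
    obtain ⟨h1, h2, h3⟩ := hall (relabel D σ) fun i j => by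
      rw [hσ]
      exact arc_eq_one.symm
    have h4 := two_mul_size_add_missing h2
    rw [size_relabel] at h4
    refine ⟨?_, by omega⟩
    have h5 := h1.relabel σ.symm
    have h6 : relabel (relabel D σ) σ.symm = D := by
      ext i j
      simp [relabel]
    rwa [h6] at h5
  obtain h | h | ⟨m, hm, h⟩ | ⟨k, hk, hk3, h⟩ := h
  · exact key _ h fun D' hD' => extremal_F₁ hn hD'
  · exact key _ h fun D' hD' => extremal_F₂ hn hD'
  · exact key _ h fun D' hD' => extremal_F₃ hn hm hD'
  · exact key _ h fun D' hD' => extremal_F₄ hn hk hk3 hD'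

/-- `ex n (n - 4) = n * (n - 1) / 2 - 4`. -/
theorem two_mul_ex_add (hn : 9 ≤ n) : 2 * ex n (n - 4) + 8 + n = n * n := by
  let D : Digraph (Fin n) := ⟨fun i j => F₁ n i j = 1⟩
  obtain ⟨h1, h2, h3⟩ := extremal_F₁ (D := D) hn fun _ _ => Iff.rfl
  have h4 := two_mul_size_add_missing h2
  have h5 := (h1.size_le hn).1
  have hub : ∀ m ∈ {m : ℕ | ∃ D : Digraph (Fin n), WalkFree (n - 4) D ∧ size D = m},
      m ≤ size D := by
    rintro m ⟨D', hD', rfl⟩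
    have := (hD'.size_le hn).1
    omega
  have hex : ex n (n - 4) = size D := IsGreatest.csSup_eq ⟨⟨D, h1, rfl⟩, hub⟩
  omega

end Lower

end WalkTuran

theorem theorem3p8 (n : ℕ) (hn : 9 ≤ n) (D : Digraph (Fin n)) :
    D ∈ WalkTuran.Ex n (n - 4) ↔
      (WalkTuran.PermSimilar (WalkTuran.adjMatrix D) (WalkTuran.F₁ n) ∨
        WalkTuran.PermSimilar (WalkTuran.adjMatrix D) (WalkTuran.F₂ n) ∨
        (∃ m : ℕ, m ≤ n - 7 ∧
          WalkTuran.PermSimilar (WalkTuran.adjMatrix D) (WalkTuran.F₃ n m)) ∨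
        (∃ k : Fin 4 → ℕ, StrictMono k ∧ k 3 ≤ n - 5 ∧
          WalkTuran.PermSimilar (WalkTuran.adjMatrix D) (WalkTuran.F₄ n k))) := by
  have hex := WalkTuran.two_mul_ex_add hn
  constructor
  · rintro ⟨h1, h2⟩
    exact (h1.size_le hn).2 (by omega)
  · intro h
    obtain ⟨h1, h2⟩ := WalkTuran.IsExtremalMatrix.walkFree_and_size hn h
    have := (h1.size_le hn).1
    exact ⟨h1, by omega⟩
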